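/- Let $k$ be an algebraically closed field and let $A=\bigoplus_{n\ge 0}A_n$ be a standard graded $k$-algebra (that is, $A_0=k$ and $A$ is generated as a $k$-algebra by the finite-dimensional space $A_1$) of Krull dimension $d\ge 1$. A reduction of $A$ is an ideal $Q$ generated by linear forms with $Q_n=A_n$ for all large $n$; $\operatorname{core}(A)$ denotes the intersection of all minimal reductions of $A$ (minimal with respect to inclusion). Let $x_1,\dots,x_m$ be linear forms spanning $A_1$, let $u=(u_{ij}\mid 1\le i\le d,\ 1\le j\le m)$ be indeterminates, put $z_i=u_{i1}x_1+\cdots+u_{im}x_m$ and $Q_u=(z_1,\dots,z_d)\subseteq A[u]$. Put $h_n=\dim_k A_n$ and fix a $k$-basis $\mathcal B_n$ of $A_n$ for every $n\ge 0$. For $n\ge 1$ let $M_n$ be the matrix over $k[u]$ whose rows are the coefficients, with respect to $\mathcal B_n$, of the elements $z_if$ with $1\le i\le d$, $f\in\mathcal B_{n-1}$, and let $I_t(M_n)\subseteq k[u]$ be the ideal generated by the $t$-minors of $M_n$ (with $I_0(M_n)=k[u]$). Let $V_{n,t}\subseteq\mathbb P_k^{dm-1}$ be the zero locus of $I_t(M_n)$,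 and put $V_0=\mathbb P_k^{dm-1}$ and $V_n=V_{n,h_n}$ for $n\ge 1$. Then there is a largest integer $r$ with $V_r\ne V_{r+1}$, and $r$ equals the big reduction number $\operatorname{br}(A)$, i.e. the supremum, over all minimal reductions $Q$ of $A$, of the largest $n$ with $Q_n\neq A_n$. Put $J=I_{h_{r+1}}(M_{r+1})$, and let $\mathcal S$ be the set of all admissible sequences, i.e. of all sequences $(a_1,\dots,a_r)$ of $r$ positive integers for which $$\bigcap_{n=1}^r\bigl(V_{n,a_n+1}\setminus(V_{n,a_n}\cup V_{r+1})\bigr)\neq\emptyset ,$$ where an empty intersection (the case $r=0$) means $\mathbb P_k^{dm-1}$. Then $$\operatorname{core}(A)=\bigcap_{(a_1,\dots,a_r)\in\mathcal S}\Bigl[\Bigl(Q_u+\sum_{n=1}^r\sqrt{I_{a_n+1}(M_n)}\Bigr):J\prod_{n=1}^rI_{a_n}(M_n)\Bigr]\cap A ,$$ where the radicals are taken in $k[u]$, and ideals of $k[u]$ are extended to $A[u]$ to form the sum and the colon ideal in $A[u]$. -/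

import Mathlib

namespace GradedCore

section Reductions

variable {k A : Type*} [Field k] [CommRing A] [Algebra k A]

/-- `A = ⨁ₙ 𝒜 n` is a standard graded `k`-algebra: `A₀ = k`, and `A` is generated as a
`k`-algebra by the finite-dimensional space `A₁`. -/
structure IsStandardGraded (𝒜 : ℕ → Submodule k A) [GradedAlgebra 𝒜] : Prop where
  nontrivial : Nontrivial A
  /-- `A₀` is the image of `k` (and `k → A` is injective, as `A ≠ 0`). -/
  degree_zero : 𝒜 0 = 1
  finite_degree_one : (𝒜 1).FG
  adjoin_degree_one : Algebra.adjoin k (𝒜 1 : Set A) = ⊤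

/-- A reduction of `A`: an ideal `Q` generated by linear forms (hence graded) such that
`Qₙ = Aₙ` for all large `n`. -/
def IsReduction (𝒜 : ℕ → Submodule k A) (Q : Ideal A) : Prop :=
  (∃ s : Set A, s ⊆ (𝒜 1 : Set A) ∧ Q = Ideal.span s) ∧
    ∃ n₀ : ℕ, ∀ n, n₀ ≤ n → ∀ a ∈ 𝒜 n, a ∈ Q

/-- A minimal reduction: a reduction that is minimal with respect to inclusion. -/
def IsMinimalReduction (𝒜 : ℕ → Submodule k A) (Q : Ideal A) : Prop :=
  Minimal (IsReduction 𝒜) Q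

/-- The graded core of `A`: the intersection of all minimal reductions of `A`. -/
def gradedCore (𝒜 : ℕ → Submodule k A) : Ideal A :=
  sInf {Q | IsMinimalReduction 𝒜 Q}

/-- The reduction number `r_Q(A)`: the largest `n` with `Qₙ ≠ Aₙ`, as a supremum in `ℕ∞`. -/
noncomputable def reductionNumber (𝒜 : ℕ → Submodule k A) (Q : Ideal A) : ℕ∞ :=
  ⨆ n ∈ {n : ℕ | ∃ a ∈ 𝒜 n, a ∉ Q}, (n : ℕ∞)

/-- The big reduction number `br(A)`: the supremum of the reduction numbers of the minimal
reductions of `A`. -/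
noncomputable def bigReductionNumber (𝒜 : ℕ → Submodule k A) : ℕ∞ :=
  ⨆ Q ∈ {Q | IsMinimalReduction 𝒜 Q}, reductionNumber 𝒜 Q

end Reductions

section Minors

/-- `I_t(M)`: the ideal generated by the `t`-minors of `M`. It is the unit ideal for `t = 0`
and the zero ideal when `t` exceeds the number of rows or columns. -/
def minorIdeal {R ρ κ : Type*} [CommRing R] (M : Matrix ρ κ R) (t : ℕ) : Ideal R :=
  Ideal.span {f | ∃ (p : Fin t ↪ ρ) (q : Fin t ↪ κ), f = (M.submatrix p q).det}

/-- The zero locus in projective space of a (homogeneous) ideal of the polynomial ring: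
the points at all of whose homogeneous coordinate vectors the ideal vanishes. -/
def projZeroLocus {k σ : Type*} [Field k] (I : Ideal (MvPolynomial σ k)) :
    Set (Projectivization k (σ → k)) :=
  {α | ∀ (v : σ → k) (hv : v ≠ 0), Projectivization.mk k v hv = α →
    ∀ f ∈ I, MvPolynomial.eval v f = 0}

end Minors

section Generic

variable {k A : Type*} [Field k] [CommRing A] [Algebra k A] {m : ℕ}

/-- The generic linear form `z_i = u_{i1} x_1 + ⋯ + u_{im} x_m` of `A[u]`. -/
noncomputable def genericForm (d : ℕ) (x : Fin m → A) (i : Fin d) :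
    MvPolynomial (Fin d × Fin m) A :=
  ∑ j, MvPolynomial.X (i, j) * MvPolynomial.C (x j)

/-- The ideal `Q_u = (z_1, …, z_d)` of `A[u]`. -/
noncomputable def genericReduction (d : ℕ) (x : Fin m → A) :
    Ideal (MvPolynomial (Fin d × Fin m) A) :=
  Ideal.span (Set.range (genericForm d x))

/-- The inclusion `k[u] → A[u]`. -/
noncomputable def coeffHom (k A : Type*) [Field k] [CommRing A] [Algebra k A] (σ : Type*) :
    MvPolynomial σ k →+* MvPolynomial σ A :=
  MvPolynomial.map (algebraMap k A)

variable (𝒜 : ℕ → Submodule k A) [GradedAlgebra 𝒜] (d : ℕ) (x : Fin m → A)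
  (B : ∀ n, Module.Basis (Fin (Module.finrank k (𝒜 n))) k (𝒜 n))

/-- The matrix `M_n` over `k[u]` for `n ≥ 1`: its row `(i, f)` consists of the coefficients of
`z_i f = ∑ j, u_{ij} x_j f` in the basis `B n` of `A_n`, where `f` runs through the basis
`B (n - 1)` of `A_{n-1}`. If the `x_j` are linear forms then `x_j f` lies in `A_n`, so that taking
its degree-`n` component changes nothing when `n ≥ 1`; for `n = 0` it yields the zero matrix
with `h_0 = 1` columns, in accordance with the convention that `V_0` is the whole space. -/
noncomputable def coeffMatrix (n : ℕ) :
    Matrix (Fin d × Fin (Module.finrank k (𝒜 (n - 1)))) (Fin (Module.finrank k (𝒜 n)))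
      (MvPolynomial (Fin d × Fin m) k) :=
  fun p b => ∑ j, MvPolynomial.X (p.1, j) *
    MvPolynomial.C ((B n).repr (DirectSum.decompose 𝒜 (x j * (B (n - 1) p.2 : A)) n) b)

/-- The rows of `M_n` are indeed the coefficients of the elements `z_i f`. -/
theorem genericForm_mul_basis (hx : ∀ j, x j ∈ 𝒜 1) {n : ℕ} (hn : 1 ≤ n)
    (i : Fin d) (f : Fin (Module.finrank k (𝒜 (n - 1)))) :
    genericForm d x i * MvPolynomial.C (B (n - 1) f : A) =
      ∑ b, coeffHom k A _ (coeffMatrix 𝒜 d x B n (i, f) b) * MvPolynomial.C (B n b : A) := by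
  have key : ∀ j, x j * (B (n - 1) f : A) =
      ∑ b, algebraMap k A
        ((B n).repr (DirectSum.decompose 𝒜 (x j * (B (n - 1) f : A)) n) b) * (B n b : A) := by
    intro j
    have hmem : x j * (B (n - 1) f : A) ∈ 𝒜 n := by
      have h := SetLike.mul_mem_graded (hx j) (B (n - 1) f).2
      rwa [Nat.add_sub_cancel' hn] at h
    have h := congrArg (Subtype.val)
      ((B n).sum_repr (DirectSum.decompose 𝒜 (x j * (B (n - 1) f : A)) n))
    rw [DirectSum.decompose_of_mem_same 𝒜 hmem] at h
    refine h.symm.trans ?_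
    rw [AddSubmonoidClass.coe_finsetSum]
    exact Finset.sum_congr rfl fun b _ => by rw [Submodule.coe_smul, Algebra.smul_def]
  simp only [genericForm, coeffMatrix, coeffHom, map_sum, map_mul, MvPolynomial.map_X,
    MvPolynomial.map_C, Finset.sum_mul]
  rw [Finset.sum_comm]
  refine Finset.sum_congr rfl fun j _ => ?_
  rw [mul_assoc, ← map_mul]
  refine (congrArg (fun y => MvPolynomial.X (i, j) * MvPolynomial.C y) (key j)).trans ?_
  dsimp only
  rw [map_sum, Finset.mul_sum]
  exact Finset.sum_congr rfl fun b _ => by rw [map_mul, mul_assoc]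

/-- `I_t(M_n)`. -/
noncomputable def coeffMinors (n t : ℕ) : Ideal (MvPolynomial (Fin d × Fin m) k) :=
  minorIdeal (coeffMatrix 𝒜 d x B n) t

/-- `V_{n,t}`: the zero locus of `I_t(M_n)` in `ℙ^{dm-1}`. -/
noncomputable def minorLocus (n t : ℕ) : Set (Projectivization k (Fin d × Fin m → k)) :=
  projZeroLocus (coeffMinors 𝒜 d x B n t)

/-- `V_n`: the zero locus of `I_{h_n}(M_n)`, where `h_n = dim_k A_n`. -/
noncomputable def degenLocus (n : ℕ) : Set (Projectivization k (Fin d × Fin m → k)) :=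
  minorLocus 𝒜 d x B n (Module.finrank k (𝒜 n))

/-- `V_H` for `H = (a_1, …, a_r)`; the entry `a_n` is `a i` with `n = i + 1`. -/
noncomputable def stratum (r : ℕ) (a : Fin r → ℕ) :
    Set (Projectivization k (Fin d × Fin m → k)) :=
  ⋂ i : Fin r, minorLocus 𝒜 d x B (i + 1) (a i + 1) \
    (minorLocus 𝒜 d x B (i + 1) (a i) ∪ degenLocus 𝒜 d x B (r + 1))

/-- The set of admissible sequences: the sequences `H` of `r` positive integers such that
`V_H` is non-empty. -/
def admissible (r : ℕ) : Set (Fin r → ℕ) :=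
  {a | (∀ i, 0 < a i) ∧ (stratum 𝒜 d x B r a).Nonempty}

end Generic

end GradedCore

/-! Write `Q_v` for the specialization of `Q_u` at a point `v` and `M_n(v)` for that of `M_n`. By
graded Noether normalization the minimal reductions are exactly the `Q_v` that are reductions
(`isMinimalReduction_iff`). For `n ≥ 1` the rows of `M_n(v)` span `(Q_v)_n`
(`mem_specialIdeal_iff`), so its rank is `dim (Q_v)_n`, and `V_n` is the set of `v` with `(Q_v)_n ≠
A_n`. The `V_n` decrease and become stationary by noetherianity. Hence `r` exists, `Q_v` is a
reduction exactly for `v` off `V_{r+1}`, and a point of `V_r \ V_{r+1}` gives a minimal reduction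
with reduction number `r`. The core is thus the intersection of the `Q_v` with `v` off `V_{r+1}`.

If `f` lies in all the colon ideals and `Q_v` is a reduction, take `a_n = rank M_n(v)`. This
sequence is admissible, and some `g` in `J ∏ I_{a_n}(M_n)` has `g(v) ≠ 0`. Evaluating at `v` puts
`g(v) f`, hence `f`, into `Q_v`.

Conversely let `f` in the core be homogeneous of degree `n`. If `n > r`, Cramer's rule gives `J f ⊆
Q_u`. If `1 ≤ n ≤ r`, expanding bordered minors shows that a `t`-minor times `f` is, modulo `Q_u`, a
combination of `(t+1)`-minors of `M_n` bordered by the coefficients of `f`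
(`mul_minor_sub_sum_mem`). Where `M_n(v)` has rank at most `t`, either `J` vanishes or `Q_v` is a
reduction containing `f`; then the border is in the row space and the bordered minor vanishes. The
Nullstellensatz puts `J` times it into `√I_{t+1}(M_n)`. This inclusion holds for every sequence `a`,
admissible or not. -/

namespace GradedCore

open DirectSum

/-! ### Standard graded algebras and ideals generated by linear forms. -/

section Graded

variable {k A : Type*} [Field k] [CommRing A] [Algebra k A]
  (𝒜 : ℕ → Submodule k A) [GradedAlgebra 𝒜]

/-- In a standard graded algebra, `A_n` is the `n`-th power of `A_1`. -/
theorem IsStandardGraded.eq_pow {𝒜 : ℕ → Submodule k A} [GradedAlgebra 𝒜]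
    (hA : IsStandardGraded 𝒜) (n : ℕ) : 𝒜 n = 𝒜 1 ^ n := by
  have hle : ∀ i, 𝒜 1 ^ i ≤ 𝒜 i := by
    intro i
    induction i with
    | zero => rw [pow_zero, hA.degree_zero]
    | succ i ih =>
      rw [pow_succ]
      exact Submodule.mul_le.2 fun a ha b hb => SetLike.mul_mem_graded (ih ha) hb
  refine le_antisymm ?_ (hle n)
  -- Products of linear forms span `A`, and each of them is homogeneous.
  have key : ∀ a : A, (decompose 𝒜 a n : A) ∈ 𝒜 1 ^ n := by
    intro a
    have ha : a ∈ Submodule.span k (Submonoid.closure (𝒜 1 : Set A) : Set A) := by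
      rw [← Algebra.adjoin_eq_span, hA.adjoin_degree_one]; trivial
    induction ha using Submodule.span_induction with
    | mem a ha =>
      obtain ⟨i, hi⟩ : ∃ i, a ∈ 𝒜 1 ^ i := by
        induction ha using Submonoid.closure_induction with
        | mem a ha => exact ⟨1, by simpa using ha⟩
        | one => exact ⟨0, by rw [pow_zero]; exact Submodule.one_le.1 le_rfl⟩
        | mul a b _ _ iha ihb =>
          obtain ⟨i, hi⟩ := iha
          obtain ⟨j, hj⟩ := ihb
          exact ⟨i + j, by rw [pow_add]; exact Submodule.mul_mem_mul hi hj⟩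
      by_cases h : i = n
      · subst h; rwa [decompose_of_mem_same 𝒜 (hle _ hi)]
      · rw [decompose_of_mem_ne 𝒜 (hle _ hi) h]; exact zero_mem _
    | zero => simp
    | add a b _ _ iha ihb => simpa using add_mem iha ihb
    | smul c a _ iha =>
      rw [decompose_smul]
      exact Submodule.smul_mem _ c iha
  intro a ha
  simpa [decompose_of_mem_same 𝒜 ha] using key a

theorem IsStandardGraded.add_eq_mul {𝒜 : ℕ → Submodule k A} [GradedAlgebra 𝒜]
    (hA : IsStandardGraded 𝒜) (i j : ℕ) : 𝒜 (i + j) = 𝒜 i * 𝒜 j := by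
  rw [hA.eq_pow, hA.eq_pow i, hA.eq_pow j, pow_add]

/-- `A_n ⊆ Q` implies `A_m ⊆ Q` for all `m ≥ n`. -/
theorem IsStandardGraded.le_of_le {𝒜 : ℕ → Submodule k A} [GradedAlgebra 𝒜]
    (hA : IsStandardGraded 𝒜) {Q : Ideal A} {n m : ℕ} (hnm : n ≤ m)
    (h : ∀ a ∈ 𝒜 n, a ∈ Q) : ∀ a ∈ 𝒜 m, a ∈ Q := by
  obtain ⟨l, rfl⟩ := Nat.exists_eq_add_of_le' hnm
  intro a ha
  rw [hA.add_eq_mul] at ha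
  exact Submodule.mul_induction_on ha (fun b _ c hc => Q.mul_mem_left _ (h c hc))
    fun _ _ => Q.add_mem

/-- Homogeneous elements of positive degree of an ideal generated by finitely many linear
forms. -/
theorem exists_eq_sum_mul_of_mem_span {ι : Type*} [Fintype ι] {y : ι → A}
    (hy : ∀ i, y i ∈ 𝒜 1) {n : ℕ} {a : A} (ha : a ∈ 𝒜 (n + 1))
    (h : a ∈ Ideal.span (Set.range y)) :
    ∃ b : ι → A, (∀ i, b i ∈ 𝒜 n) ∧ a = ∑ i, y i * b i := by
  obtain ⟨c, rfl⟩ := Ideal.mem_span_range_iff_exists_fun.1 h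
  refine ⟨fun i => decompose 𝒜 (c i) n, fun i => SetLike.coe_mem _, ?_⟩
  conv_lhs => rw [← decompose_of_mem_same 𝒜 ha]
  rw [decompose_sum, DFinsupp.finsetSum_apply, AddSubmonoidClass.coe_finsetSum]
  refine Finset.sum_congr rfl fun i _ => ?_
  rw [coe_decompose_mul_add_of_right_mem 𝒜 (hy i), mul_comm]

/-- The projection of `A` onto `A_0` is a ring homomorphism that kills linear forms. -/
theorem eq_zero_of_mem_span_of_mem_zero {s : Set A} (hs : s ⊆ 𝒜 1) {a : A}
    (ha : a ∈ 𝒜 0) (h : a ∈ Ideal.span s) : a = 0 := by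
  rw [← decompose_of_mem_same 𝒜 ha]
  clear ha
  induction h using Submodule.span_induction with
  | mem a ha => exact decompose_of_mem_ne 𝒜 (hs ha) one_ne_zero
  | zero => simp
  | add a b _ _ iha ihb => rw [decompose_add, DirectSum.add_apply, Submodule.coe_add, iha, ihb,
      add_zero]
  | smul c a _ iha =>
    have hm := map_mul (GradedRing.projZeroRingHom 𝒜) c a
    simp only [GradedRing.projZeroRingHom_apply] at hm
    rw [smul_eq_mul, hm, iha, mul_zero]

theorem decompose_mem_span {s : Set A} (hs : s ⊆ 𝒜 1) {a : A}
    (h : a ∈ Ideal.span s) (n : ℕ) : (decompose 𝒜 a n : A) ∈ Ideal.span s :=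
  Ideal.homogeneous_span 𝒜 s (fun _ hx => ⟨1, hs hx⟩) n h

end Graded

/-! ### Krull dimension of integral extensions. -/

section Dimension

variable {R S : Type*} [CommRing R] [CommRing S] [Algebra R S] [Algebra.IsIntegral R S]

-- Incomparability makes contraction of primes strictly monotone; lying over and going up lift
-- chains of primes from `R` to `S`.
variable (R S) in
theorem ringKrullDim_eq_of_isIntegral_of_injective
    (h : Function.Injective (algebraMap R S)) : ringKrullDim S = ringKrullDim R := by
  apply le_antisymm
  · exact Order.krullDim_le_of_strictMono (PrimeSpectrum.comap (algebraMap R S))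
      fun P Q hPQ => Ideal.IsIntegral.comap_lt_comap hPQ
  · refine iSup_le fun l => ?_
    obtain ⟨P, -, hP, hPl⟩ := Ideal.exists_ideal_over_prime_of_isIntegral
      l.head.asIdeal (⊥ : Ideal S) (by
        change RingHom.ker _ ≤ _
        rw [(RingHom.injective_iff_ker_eq_bot _).1 h]; exact bot_le)
    have : P.LiesOver l.head.asIdeal := ⟨hPl.symm⟩
    obtain ⟨L, hL, -⟩ := Ideal.exists_ltSeries_of_hasGoingUp l P
    rw [← hL]
    exact le_iSup (fun p : LTSeries (PrimeSpectrum S) => (p.length : WithBot ℕ∞)) L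

end Dimension

/-! ### Graded Noether normalization inside a reduction. -/

section Noether

variable {k A : Type*} [Field k] [CommRing A] [Algebra k A]
  {𝒜 : ℕ → Submodule k A} [GradedAlgebra 𝒜]

theorem IsStandardGraded.finite (hA : IsStandardGraded 𝒜) (n : ℕ) :
    Module.Finite k (𝒜 n) := by
  rw [Module.Finite.iff_fg, hA.eq_pow]
  exact hA.finite_degree_one.pow n

/-- An ideal generated by linear forms is a reduction if it contains some `A_n`. -/
theorem IsStandardGraded.isReduction_span (hA : IsStandardGraded 𝒜) {s : Set A}
    (hs : s ⊆ 𝒜 1) {n : ℕ} (h : ∀ a ∈ 𝒜 n, a ∈ Ideal.span s) :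
    IsReduction 𝒜 (Ideal.span s) :=
  ⟨⟨s, hs, rfl⟩, n, fun _ hm => hA.le_of_le hm h⟩

/-- Some power `Q ^ e` lies in the span of `s`, and `A_{ne} = (A_n)^e ⊆ Q ^ e` once `A_n ⊆ Q`. -/
theorem IsStandardGraded.isReduction_of_le_radical (hA : IsStandardGraded 𝒜) {Q : Ideal A}
    (hQ : IsReduction 𝒜 Q) {s : Set A} (hs : s ⊆ 𝒜 1) (hfg : Q.FG)
    (h : Q ≤ (Ideal.span s).radical) : IsReduction 𝒜 (Ideal.span s) := by
  obtain ⟨-, n, hn⟩ := hQ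
  obtain ⟨e, he⟩ := Ideal.exists_pow_le_of_le_radical_of_fg h hfg
  refine hA.isReduction_span hs (n := n * e) fun a ha => he ?_
  rw [hA.eq_pow, pow_mul, ← hA.eq_pow] at ha
  have hle : 𝒜 n ^ e ≤ (Q ^ e).restrictScalars k := by
    clear ha he
    induction e with
    | zero => simp
    | succ e ih =>
      rw [pow_succ]
      exact Submodule.mul_le.2 fun b hb c hc => by
        rw [Submodule.restrictScalars_mem, pow_succ]
        exact Ideal.mul_mem_mul (ih hb) (hn n le_rfl c hc)
  exact hle ha

theorem aeval_mul_of_isHomogeneous {σ S : Type*} [Fintype σ] [CommRing S] [Algebra k S]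
    {F : MvPolynomial σ k} {e : ℕ} (hF : F.IsHomogeneous e) (c : σ → S) (z : S) :
    MvPolynomial.aeval (fun i => c i * z) F = MvPolynomial.aeval c F * z ^ e := by
  rw [MvPolynomial.aeval_def, MvPolynomial.aeval_def, MvPolynomial.eval₂_eq',
    MvPolynomial.eval₂_eq', Finset.sum_mul]
  refine Finset.sum_congr rfl fun m hm => ?_
  have h : ∑ i, m i = e := by
    rw [← hF (MvPolynomial.mem_support_iff.1 hm), ← Finsupp.degree_eq_sum,
      Finsupp.degree_eq_weight_one]
    rfl
  simp only [mul_pow, Finset.prod_mul_distrib, Finset.prod_pow_eq_pow_sum, h, mul_assoc]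

variable (𝒜) in
theorem aeval_mem_of_isHomogeneous {σ : Type*} {y : σ → A} (hy : ∀ i, y i ∈ 𝒜 1)
    {F : MvPolynomial σ k} {e : ℕ} (hF : F.IsHomogeneous e) :
    MvPolynomial.aeval y F ∈ 𝒜 e := by
  rw [MvPolynomial.aeval_def, MvPolynomial.eval₂_eq]
  refine Submodule.sum_mem _ fun m hm => ?_
  rw [← Algebra.smul_def]
  refine Submodule.smul_mem _ _ ?_
  have h : ∑ i ∈ m.support, m i • 1 = e := by
    rw [← hF (MvPolynomial.mem_support_iff.1 hm), Pi.one_def, ← Finsupp.degree_eq_weight_one]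
    simp only [smul_eq_mul, mul_one]
    rfl
  rw [← h]
  exact SetLike.prod_pow_mem_graded 𝒜 (fun _ => 1) y m fun i _ => hy i

variable (𝒜) in
/-- Algebraically dependent linear forms satisfy a homogeneous relation. -/
theorem exists_homogeneous_relation {σ : Type*} {y : σ → A} (hy : ∀ i, y i ∈ 𝒜 1)
    (hdep : ¬ AlgebraicIndependent k y) :
    ∃ (F : MvPolynomial σ k) (e : ℕ), F.IsHomogeneous e ∧ F ≠ 0 ∧
      MvPolynomial.aeval y F = 0 := by
  rw [algebraicIndependent_iff] at hdep
  push Not at hdep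
  obtain ⟨F, hF, hF0⟩ := hdep
  obtain ⟨e, he⟩ : ∃ e, MvPolynomial.homogeneousComponent e F ≠ 0 := by
    by_contra! h
    exact hF0 (by rw [← MvPolynomial.sum_homogeneousComponent F]; simp [h])
  refine ⟨_, e, MvPolynomial.homogeneousComponent_isHomogeneous e F, he, ?_⟩
  have hmem := fun n => aeval_mem_of_isHomogeneous 𝒜 hy
    (MvPolynomial.homogeneousComponent_isHomogeneous n F)
  -- The degree `e` part of `F(y)` is the value at `y` of the degree `e` component of `F`.
  have hsum := congrArg (fun a => (decompose 𝒜 a e : A)) hF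
  have hle : e ∈ Finset.range (F.totalDegree + 1) := by
    by_contra h
    exact he (MvPolynomial.homogeneousComponent_eq_zero _ _ (by simpa using h))
  simp only [decompose_zero, DirectSum.zero_apply, ZeroMemClass.coe_zero] at hsum
  rw [← MvPolynomial.sum_homogeneousComponent F, map_sum, decompose_sum,
    DFinsupp.finsetSum_apply, AddSubmonoidClass.coe_finsetSum, Finset.sum_eq_single e] at hsum
  · rwa [decompose_of_mem_same 𝒜 (hmem e)] at hsum
  · exact fun n _ hn => decompose_of_mem_ne 𝒜 (hmem n) hn
  · exact fun h => absurd hle h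

/-- A reduction generated by algebraically dependent linear forms contains a reduction with one
generator less. -/
theorem IsStandardGraded.exists_smaller_reduction [Infinite k] (hA : IsStandardGraded 𝒜) {t : ℕ}
    {y : Fin (t + 1) → A} (hy : ∀ i, y i ∈ 𝒜 1)
    (hQ : IsReduction 𝒜 (Ideal.span (Set.range y))) (hdep : ¬ AlgebraicIndependent k y) :
    ∃ y' : Fin t → A, (∀ i, y' i ∈ Submodule.span k (Set.range y)) ∧
      IsReduction 𝒜 (Ideal.span (Set.range y')) := by
  obtain ⟨F, e, hF, hF0, hFy⟩ := exists_homogeneous_relation 𝒜 hy hdep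
  -- The factor `X 0` forces `c 0 ≠ 0`, so that `c` can be rescaled to have first coordinate `1`.
  obtain ⟨c, hc⟩ : ∃ c, MvPolynomial.eval c (F * MvPolynomial.X 0) ≠ 0 := by
    by_contra! h
    exact mul_ne_zero hF0 (MvPolynomial.X_ne_zero 0)
      ((hF.mul (MvPolynomial.isHomogeneous_X k 0)).eq_zero_of_forall_eval_eq_zero h)
  rw [map_mul, MvPolynomial.eval_X, mul_ne_zero_iff] at hc
  obtain ⟨hcF, hc0⟩ := hc
  set c' : Fin (t + 1) → k := fun i => c i * (c 0)⁻¹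
  have hc' : MvPolynomial.aeval c' F ≠ 0 := by
    rw [aeval_mul_of_isHomogeneous hF c]
    exact mul_ne_zero hcF (pow_ne_zero _ (inv_ne_zero hc0))
  have hc'0 : c' 0 = 1 := mul_inv_cancel₀ hc0
  set y' : Fin t → A := fun i => y i.succ - c' i.succ • y 0
  have hy' : ∀ i, y' i ∈ Submodule.span k (Set.range y) := fun i =>
    sub_mem (Submodule.subset_span ⟨_, rfl⟩)
      (Submodule.smul_mem _ _ (Submodule.subset_span ⟨_, rfl⟩))
  have hspan : Submodule.span k (Set.range y) ≤ 𝒜 1 :=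
    Submodule.span_le.2 (Set.range_subset_iff.2 hy)
  refine ⟨y', hy', hA.isReduction_of_le_radical hQ
    (Set.range_subset_iff.2 fun i => hspan (hy' i)) (Submodule.fg_span (Set.finite_range y)) ?_⟩
  have hsub : ∀ i, y i - c' i • y 0 ∈ Ideal.span (Set.range y') := by
    refine Fin.cases ?_ fun i => ?_
    · simp [hc'0]
    · exact Ideal.subset_span ⟨i, rfl⟩
  -- Modulo the `y'` each `y i` is `c' i • y 0`, so `F(y) = 0` becomes `F(c') (y 0)^e = 0` with
  -- `F(c') ≠ 0`.
  have h0 : y 0 ∈ (Ideal.span (Set.range y')).radical := by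
    refine ⟨e, ?_⟩
    let π := Ideal.Quotient.mkₐ k (Ideal.span (Set.range y'))
    have hπ : ∀ i, π (y i) = algebraMap k _ (c' i) * π (y 0) := fun i => by
      rw [← Algebra.smul_def, ← map_smul]
      exact Ideal.Quotient.eq.2 (hsub i)
    have h := congrArg π hFy
    rw [map_zero, ← AlgHom.comp_apply, MvPolynomial.comp_aeval] at h
    have h' : (fun i => π (y i)) = fun i => algebraMap k _ (c' i) * π (y 0) := funext hπ
    have hc'' : MvPolynomial.aeval (fun i => algebraMap k (A ⧸ Ideal.span (Set.range y')) (c' i)) F =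
        algebraMap k _ (MvPolynomial.aeval c' F) := MvPolynomial.aeval_algebraMap_apply _ c' F
    rw [h', aeval_mul_of_isHomogeneous hF, hc'', ← Algebra.smul_def,
      ← map_pow] at h
    exact Ideal.Quotient.eq_zero_iff_mem.1 ((smul_eq_zero.1 h).resolve_left hc')
  refine Ideal.span_le.2 (Set.range_subset_iff.2 fun i => ?_)
  have := add_mem (Ideal.le_radical (hsub i))
    (Ideal.mul_mem_left _ (algebraMap k A (c' i)) h0)
  rwa [← Algebra.smul_def, sub_add_cancel] at this

/-- `A` is finite over the polynomial ring in the generators of a reduction. -/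
theorem IsStandardGraded.isIntegral_of_isReduction (hA : IsStandardGraded 𝒜) {t : ℕ}
    {y : Fin t → A} (hy : ∀ i, y i ∈ 𝒜 1) (hQ : IsReduction 𝒜 (Ideal.span (Set.range y))) :
    (MvPolynomial.aeval (R := k) y).toRingHom.IsIntegral := by
  obtain ⟨-, N, hN⟩ := hQ
  let _ := (MvPolynomial.aeval (R := k) y).toRingHom.toAlgebra
  have hX : ∀ (i : Fin t) (a : A), (MvPolynomial.X i : MvPolynomial (Fin t) k) • a = y i * a :=
    fun i a => by
      rw [Algebra.smul_def]
      exact congrArg (· * a) (MvPolynomial.aeval_X y i)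
  have hC : ∀ (c : k) (a : A), (MvPolynomial.C c : MvPolynomial (Fin t) k) • a = c • a :=
    fun c a => by
      rw [Algebra.smul_def, Algebra.smul_def]
      exact congrArg (· * a) (MvPolynomial.aeval_C y c)
  have := hA.finite
  choose s hs using fun n => (Module.Finite.iff_fg (N := 𝒜 n)).1 (hA.finite n)
  -- For degrees at least `N`, `A_{n+1} = ∑ y_i A_n`, so `k`-generators in degrees below `N`
  -- generate `A` over the polynomial ring.
  let G : Set A := ⋃ n ∈ Finset.range N, (s n : Set A)
  have hG : G.Finite := Set.Finite.biUnion (Finset.finite_toSet _) fun n _ => (s n).finite_toSet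
  let M := Submodule.span (MvPolynomial (Fin t) k) G
  have hlow : ∀ n < N, ∀ a ∈ 𝒜 n, a ∈ M := by
    intro n hn a ha
    rw [← hs n] at ha
    induction ha using Submodule.span_induction with
    | mem a ha =>
      exact Submodule.subset_span (Set.mem_biUnion (Finset.mem_range.2 hn) ha)
    | zero => exact zero_mem _
    | add a b _ _ iha ihb => exact add_mem iha ihb
    | smul c a _ iha => exact hC c a ▸ Submodule.smul_mem M _ iha
  have hM : ∀ n, ∀ a ∈ 𝒜 n, a ∈ M := by
    intro n
    by_cases hn : n < N
    · exact hlow n hn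
    · induction n with
      | zero =>
        intro a ha
        rw [eq_zero_of_mem_span_of_mem_zero 𝒜 (Set.range_subset_iff.2 hy) ha
          (hN 0 (not_lt.1 hn) a ha)]
        exact zero_mem _
      | succ n ih =>
        intro a ha
        obtain ⟨b, hb, rfl⟩ := exists_eq_sum_mul_of_mem_span 𝒜 hy ha (hN _ (not_lt.1 hn) a ha)
        refine sum_mem fun i _ => hX i (b i) ▸ Submodule.smul_mem M _ ?_
        by_cases hn' : n < N
        · exact hlow n hn' _ (hb i)
        · exact ih hn' _ (hb i)
  have hfin : Module.Finite (MvPolynomial (Fin t) k) A := by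
    refine ⟨Submodule.fg_def.2 ⟨G, hG, eq_top_iff.2 fun a _ => ?_⟩⟩
    classical
    rw [← sum_support_decompose 𝒜 a]
    exact sum_mem fun n _ => hM n _ (SetLike.coe_mem _)
  exact (Algebra.IsIntegral.of_finite (MvPolynomial (Fin t) k) A).isIntegral

/-- Graded Noether normalization. -/
theorem IsStandardGraded.exists_algebraicIndependent [Infinite k] (hA : IsStandardGraded 𝒜)
    {d : ℕ} (hd : ringKrullDim A = d) {Q : Ideal A} (hQ : IsReduction 𝒜 Q) :
    ∃ y : Fin d → A, (∀ i, y i ∈ 𝒜 1) ∧ (∀ i, y i ∈ Q) ∧ AlgebraicIndependent k y ∧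
      IsReduction 𝒜 (Ideal.span (Set.range y)) := by
  have := hA.nontrivial
  have := hA.finite
  -- With the least number `t` of generators the forms are independent, as a relation would save
  -- one; integrality then gives `t = d`.
  let P : ℕ → Prop := fun t => ∃ y : Fin t → A, (∀ i, y i ∈ 𝒜 1) ∧ (∀ i, y i ∈ Q) ∧
    IsReduction 𝒜 (Ideal.span (Set.range y))
  have hP : ∃ t, P t := by
    obtain ⟨⟨s, hs, rfl⟩, hN⟩ := hQ
    obtain ⟨g, hg⟩ := (Module.Finite.iff_fg.1
      (Submodule.finiteDimensional_of_le (Submodule.span_le.2 hs)) : (Submodule.span k s).FG)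
    have hgs : ∀ a ∈ g, a ∈ Submodule.span k s := fun a ha => hg ▸ Submodule.subset_span ha
    refine ⟨g.card, fun i => g.equivFin.symm i,
      fun i => Submodule.span_le.2 hs (hgs _ (Subtype.property _)),
      fun i => Submodule.span_le_restrictScalars k A s (hgs _ (Subtype.property _)), ?_⟩
    have hr : Set.range (fun i => (g.equivFin.symm i : A)) = g := by
      rw [Set.range_comp' Subtype.val, g.equivFin.symm.range_eq_univ]
      simp
    have : Ideal.span s = Ideal.span (g : Set A) := by
      rw [Ideal.span, Ideal.span, ← Submodule.span_span_of_tower k A s, ← hg,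
        Submodule.span_span_of_tower]
    rw [hr, ← this]
    exact ⟨⟨s, hs, rfl⟩, hN⟩
  classical
  obtain ⟨y, hy, hyQ, hred⟩ := Nat.find_spec hP
  have hmin := fun t => Nat.find_min hP (m := t)
  generalize Nat.find hP = t at y hmin
  have hind : AlgebraicIndependent k y := by
    by_contra hdep
    obtain _ | t := t
    · exact hdep (algebraicIndependent_empty_type_iff.2 (algebraMap k A).injective)
    · obtain ⟨y', hy', hred'⟩ := hA.exists_smaller_reduction hy hred hdep
      exact hmin t (Nat.lt_succ_self t) ⟨y',
        fun i => Submodule.span_le.2 (Set.range_subset_iff.2 hy) (hy' i),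
        fun i => (Submodule.span_le.2 (Set.range_subset_iff.2 hyQ) :
          _ ≤ Q.restrictScalars k) (hy' i), hred'⟩
  have hdim : ringKrullDim A = t := by
    let _ := (MvPolynomial.aeval (R := k) y).toRingHom.toAlgebra
    have : Algebra.IsIntegral (MvPolynomial (Fin t) k) A :=
      ⟨hA.isIntegral_of_isReduction hy hred⟩
    rw [ringKrullDim_eq_of_isIntegral_of_injective (MvPolynomial (Fin t) k) A hind]
    simp
  obtain rfl : d = t := by
    rw [hd] at hdim
    exact_mod_cast hdim
  exact ⟨y, hy, hyQ, hind, hred⟩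

end Noether

/-! ### Rank and nonvanishing minors over a field. -/

section Rank

variable {K ρ κ : Type*} [Field K] [Fintype κ]

theorem le_rank_of_det_ne_zero (M : Matrix ρ κ K) {t : ℕ} (p : Fin t → ρ) (q : Fin t → κ)
    (h : (M.submatrix p q).det ≠ 0) : t ≤ M.rank := by
  have := M.rank_submatrix_le p q
  rwa [Matrix.rank_of_det_ne_zero h, Fintype.card_fin] at this

/-- A matrix of rank at least `t` has `t` linearly independent rows. -/
theorem exists_linearIndependent_rows [Finite ρ] (M : Matrix ρ κ K) {t : ℕ} (ht : t ≤ M.rank) :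
    ∃ p : Fin t ↪ ρ, LinearIndependent K (fun i => M (p i)) := by
  obtain ⟨ι, a, ha, hspan, hli⟩ := exists_linearIndependent' K M.row
  have : Finite ι := Finite.of_injective a ha
  cases nonempty_fintype ι
  have hcard : t ≤ Fintype.card ι := by
    rw [linearIndependent_iff_card_eq_finrank_span.1 hli, Set.finrank, hspan,
      ← M.rank_eq_finrank_span_row]
    exact ht
  let e : Fin t ↪ ι := (Fin.castLEEmb hcard).trans (Fintype.equivFin ι).symm.toEmbedding
  exact ⟨e.trans ⟨a, ha⟩, hli.comp e e.injective⟩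

theorem exists_det_ne_zero_of_le_rank [Finite ρ] (M : Matrix ρ κ K) {t : ℕ} (ht : t ≤ M.rank) :
    ∃ (p : Fin t ↪ ρ) (q : Fin t ↪ κ), (M.submatrix p q).det ≠ 0 := by
  obtain ⟨p, hp⟩ := exists_linearIndependent_rows M ht
  have hr : (M.submatrix p id).transpose.rank = t := by
    rw [Matrix.rank_transpose, LinearIndependent.rank_matrix (M := M.submatrix p id) hp,
      Fintype.card_fin]
  obtain ⟨q, hq⟩ := exists_linearIndependent_rows _ hr.ge
  refine ⟨p, q, ?_⟩
  rw [← Matrix.det_transpose]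
  exact ((Matrix.isUnit_iff_isUnit_det _).1
    (Matrix.linearIndependent_rows_iff_isUnit.1 hq)).ne_zero

end Rank

/-! ### Bordered minors. -/

section Bordered

variable {R ρ κ : Type*} [CommRing R] {t : ℕ}

/-- The square submatrix of `M` with rows `p` and columns `q`, bordered by the row `w` and the
column `c`. -/
def borderedMatrix (M : Matrix ρ κ R) (w : κ → R) (p : Fin t → ρ) (q : Fin t → κ) (c : κ) :
    Matrix (Fin (t + 1)) (Fin (t + 1)) R :=
  Matrix.of fun i j => Fin.snoc (α := fun _ => κ → R) (fun i => M (p i)) w i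
    (Fin.snoc (α := fun _ => κ) q c j)

/-- Laplace expansion of the bordered minors along the bordering column. -/
theorem exists_minor_mul_eq (M : Matrix ρ κ R) (w : κ → R) (p : Fin t → ρ) (q : Fin t → κ) :
    ∃ l : Fin t → R, ∀ c, (M.submatrix p q).det * w c =
      (borderedMatrix M w p q c).det + ∑ i, l i * M (p i) c := by
  let N : Matrix (Fin (t + 1)) (Fin t) R := Matrix.of fun i j =>
    Fin.snoc (α := fun _ => κ → R) (fun i => M (p i)) w i (q j)
  -- Deleting the bordering column leaves rows of `N`, so the cofactors do not involve `c`: one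
  -- relation serves all columns.
  refine ⟨fun i => -((-1) ^ (i + t : ℕ) * (N.submatrix i.castSucc.succAbove id).det), fun c => ?_⟩
  have hsub : ∀ i : Fin (t + 1), (borderedMatrix M w p q c).submatrix i.succAbove
      (Fin.last t).succAbove = N.submatrix i.succAbove id := fun i => by
    ext a b
    simp [borderedMatrix, N]
  have hlast : N.submatrix (Fin.last t).succAbove id = M.submatrix p q := by
    ext a b
    simp [N]
  rw [Matrix.det_succ_column _ (Fin.last t), Fin.sum_univ_castSucc]
  simp only [hsub, hlast]
  have hM : ∀ i, borderedMatrix M w p q c i (Fin.last t) =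
      Fin.snoc (α := fun _ => κ → R) (fun i => M (p i)) w i c := by
    simp [borderedMatrix]
  simp only [hM, Fin.snoc_castSucc, Fin.snoc_last, Fin.val_castSucc, Fin.val_last]
  rw [add_right_comm, ← Finset.sum_add_distrib, Finset.sum_eq_zero fun i _ => by ring,
    Even.neg_one_pow ⟨t, rfl⟩]
  ring

theorem map_borderedMatrix {S : Type*} [CommRing S] (φ : R →+* S) (M : Matrix ρ κ R) (w : κ → R)
    (p : Fin t → ρ) (q : Fin t → κ) (c : κ) :
    φ (borderedMatrix M w p q c).det =
      (borderedMatrix (M.map φ) (fun j => φ (w j)) p q c).det := by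
  rw [RingHom.map_det]
  congr 1
  ext i j
  refine Fin.lastCases ?_ (fun i => ?_) i <;> simp [borderedMatrix]

/-- By pigeonhole a column is repeated. This turns the bordered expansion into Cramer's rule. -/
theorem det_borderedMatrix_eq_zero_of_card [Fintype κ] (M : Matrix ρ κ R) (w : κ → R)
    (p : Fin t → ρ) (q : Fin t → κ) (c : κ) (h : Fintype.card κ ≤ t) :
    (borderedMatrix M w p q c).det = 0 := by
  obtain ⟨i, j, hij, h⟩ := Fintype.exists_ne_map_eq_of_card_lt
    (Fin.snoc (α := fun _ => κ) q c : Fin (t + 1) → κ) (by simpa using Nat.lt_succ_of_le h)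
  exact Matrix.det_zero_of_column_eq hij fun l => by
    simp only [borderedMatrix, Matrix.of_apply, h]

/-- Adjoining to `M` a row from its row space keeps the rank at most `t`, and the bordered
determinant is a `(t+1)`-minor of the enlarged matrix. -/
theorem det_borderedMatrix_eq_zero {K : Type*} [Field K] [Finite ρ] [Fintype κ]
    (M : Matrix ρ κ K) (w : κ → K) (p : Fin t → ρ) (q : Fin t → κ) (c : κ)
    (hw : w ∈ Submodule.span K (Set.range M)) (h : M.rank ≤ t) :
    (borderedMatrix M w p q c).det = 0 := by
  by_contra hne
  let M' : Matrix (Option ρ) κ K := Matrix.of fun o => o.elim w M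
  have hsub : borderedMatrix M w p q c =
      M'.submatrix (Fin.snoc (α := fun _ => Option ρ) (fun i => some (p i)) none)
        (Fin.snoc (α := fun _ => κ) q c) := by
    ext i j
    refine Fin.lastCases ?_ (fun i => ?_) i <;> simp [borderedMatrix, M'] <;> rfl
  rw [hsub] at hne
  have hle := le_rank_of_det_ne_zero M' _ _ hne
  have hrank : M'.rank = M.rank := by
    suffices hs : Submodule.span K (Set.range M'.row) = Submodule.span K (Set.range M.row) by
      rw [Matrix.rank_eq_finrank_span_row, Matrix.rank_eq_finrank_span_row, hs]
    refine le_antisymm (Submodule.span_le.2 ?_) (Submodule.span_mono ?_)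
    · rintro _ ⟨_ | i, rfl⟩
      · exact hw
      · exact Submodule.subset_span ⟨i, rfl⟩
    · rintro _ ⟨i, rfl⟩
      exact ⟨some i, rfl⟩
  omega

end Bordered

/-! ### Specialization at a point: ranks, loci and the ideals `Q_v`. -/

section Specialization

variable {k A : Type*} [Field k] [CommRing A] [Algebra k A] {d m : ℕ}

/-- The specialization of the generic linear form `z_i` at the point `v`. -/
def specialForm (x : Fin m → A) (v : Fin d × Fin m → k) (i : Fin d) : A :=
  ∑ j, v (i, j) • x j

/-- The specialization of the ideal `Q_u` at the point `v`. -/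
def specialIdeal (x : Fin m → A) (v : Fin d × Fin m → k) : Ideal A :=
  Ideal.span (Set.range (specialForm x v))

/-- Evaluation `A[u] → A` at a point with coordinates in `k`. -/
noncomputable def evalPoint (A : Type*) [CommRing A] [Algebra k A] {σ : Type*} (v : σ → k) :
    MvPolynomial σ A →+* A :=
  MvPolynomial.eval fun i => algebraMap k A (v i)

theorem evalPoint_coeffHom {σ : Type*} (v : σ → k) (p : MvPolynomial σ k) :
    evalPoint A v (coeffHom k A σ p) = algebraMap k A (MvPolynomial.eval v p) := by
  rw [evalPoint, coeffHom, MvPolynomial.eval_map]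
  exact (MvPolynomial.eval₂_comp (algebraMap k A) v p).symm

theorem evalPoint_C {σ : Type*} (v : σ → k) (a : A) :
    evalPoint A v (MvPolynomial.C a) = a :=
  MvPolynomial.eval_C a

theorem evalPoint_genericForm (x : Fin m → A) (v : Fin d × Fin m → k) (i : Fin d) :
    evalPoint A v (genericForm d x i) = specialForm x v i := by
  simp [evalPoint, genericForm, specialForm, Algebra.smul_def]

theorem evalPoint_mem_of_mem_genericReduction (x : Fin m → A) (v : Fin d × Fin m → k)
    {f : MvPolynomial (Fin d × Fin m) A} (hf : f ∈ genericReduction d x) :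
    evalPoint A v f ∈ specialIdeal x v := by
  have h : genericReduction d x ≤ (specialIdeal x v).comap (evalPoint A v) := by
    refine Ideal.span_le.2 (Set.range_subset_iff.2 fun i => ?_)
    rw [SetLike.mem_coe, Ideal.mem_comap, evalPoint_genericForm]
    exact Ideal.subset_span ⟨i, rfl⟩
  exact h hf

theorem forall_mem_minorIdeal_eval_eq_zero_iff {σ ρ κ : Type*} [Finite ρ] [Fintype κ]
    (M : Matrix ρ κ (MvPolynomial σ k)) (t : ℕ) (v : σ → k) :
    (∀ f ∈ minorIdeal M t, MvPolynomial.eval v f = 0) ↔ (M.map (MvPolynomial.eval v)).rank < t := by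
  have hdet : ∀ (p : Fin t → ρ) (q : Fin t → κ), MvPolynomial.eval v (M.submatrix p q).det =
      ((M.map (MvPolynomial.eval v)).submatrix p q).det := fun p q => by
    rw [RingHom.map_det]
    rfl
  constructor
  · intro h
    by_contra! hle
    obtain ⟨p, q, hpq⟩ := exists_det_ne_zero_of_le_rank _ hle
    exact hpq (hdet p q ▸ h _ (Ideal.subset_span ⟨p, q, rfl⟩))
  · intro h f hf
    have hle : minorIdeal M t ≤ RingHom.ker (MvPolynomial.eval v) := by
      refine Ideal.span_le.2 ?_
      rintro _ ⟨p, q, rfl⟩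
      by_contra hne
      exact h.not_ge (le_rank_of_det_ne_zero _ p q fun h0 => hne ((hdet p q).trans h0))
    exact hle hf

theorem specialForm_mem (𝒜 : ℕ → Submodule k A) (x : Fin m → A) (hx : ∀ j, x j ∈ 𝒜 1)
    (v : Fin d × Fin m → k) (i : Fin d) : specialForm x v i ∈ 𝒜 1 :=
  Submodule.sum_mem _ fun j _ => Submodule.smul_mem _ _ (hx j)

theorem exists_specialForm_eq {𝒜 : ℕ → Submodule k A} {x : Fin m → A}
    (hx : Submodule.span k (Set.range x) = 𝒜 1) {y : Fin d → A} (hy : ∀ i, y i ∈ 𝒜 1) :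
    ∃ v : Fin d × Fin m → k, specialForm x v = y := by
  have h : ∀ i, ∃ c : Fin m → k, ∑ j, c j • x j = y i := fun i =>
    (Submodule.mem_span_range_iff_exists_fun k).1 (hx ▸ hy i)
  choose c hc using h
  exact ⟨fun p => c p.1 p.2, funext hc⟩

theorem specialIdeal_zero (x : Fin m → A) :
    specialIdeal x (0 : Fin d × Fin m → k) = ⊥ := by
  rw [specialIdeal, Ideal.span_eq_bot]
  rintro _ ⟨i, rfl⟩
  simp [specialForm]

variable (𝒜 : ℕ → Submodule k A) [GradedAlgebra 𝒜] (x : Fin m → A)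
  (B : ∀ n, Module.Basis (Fin (Module.finrank k (𝒜 n))) k (𝒜 n))

/-- The specialization of the matrix `M_n` at the point `v`. -/
noncomputable def specialMatrix (n : ℕ) (v : Fin d × Fin m → k) :
    Matrix (Fin d × Fin (Module.finrank k (𝒜 (n - 1)))) (Fin (Module.finrank k (𝒜 n))) k :=
  (coeffMatrix 𝒜 d x B n).map (MvPolynomial.eval v)

theorem specialMatrix_smul (n : ℕ) (c : k) (v : Fin d × Fin m → k) :
    specialMatrix 𝒜 x B n (c • v) = c • specialMatrix 𝒜 x B n v := by
  ext p b
  simp [specialMatrix, coeffMatrix, Finset.mul_sum, mul_assoc]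

theorem IsStandardGraded.isReduction_specialIdeal {𝒜 : ℕ → Submodule k A} [GradedAlgebra 𝒜]
    (hA : IsStandardGraded 𝒜) {x : Fin m → A}
    (hx : ∀ j, x j ∈ 𝒜 1) {v : Fin d × Fin m → k} {n : ℕ}
    (h : ∀ a ∈ 𝒜 n, a ∈ specialIdeal x v) : IsReduction 𝒜 (specialIdeal x v) :=
  hA.isReduction_span (Set.range_subset_iff.2 (specialForm_mem 𝒜 x hx v)) h

/-- The entries of `M_n` are linear in `u`, so rescaling `v` rescales the matrix and keeps its rank.
-/
theorem mk_mem_minorLocus_iff {n t : ℕ} {v : Fin d × Fin m → k} (hv : v ≠ 0) :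
    Projectivization.mk k v hv ∈ minorLocus 𝒜 d x B n t ↔ (specialMatrix 𝒜 x B n v).rank < t := by
  simp only [minorLocus, projZeroLocus, Set.mem_ofPred_eq, coeffMinors,
    forall_mem_minorIdeal_eval_eq_zero_iff]
  refine ⟨fun h => h v hv rfl, fun h w hw hwv => ?_⟩
  obtain ⟨c, rfl⟩ := (Projectivization.mk_eq_mk_iff' k w v hw hv).1 hwv
  have hc : c ≠ 0 := by
    rintro rfl
    exact hw (zero_smul _ _)
  change (specialMatrix 𝒜 x B n (c • v)).rank < t
  rwa [specialMatrix_smul, Matrix.rank_smul_of_mem_nonZeroDivisors _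
    (mem_nonZeroDivisors_of_ne_zero hc)]

theorem specialForm_mul_basis (hx : ∀ j, x j ∈ 𝒜 1) {n : ℕ} (hn : 1 ≤ n)
    (v : Fin d × Fin m → k) (p : Fin d × Fin (Module.finrank k (𝒜 (n - 1)))) :
    specialForm x v p.1 * (B (n - 1) p.2 : A) =
      ((B n).equivFun.symm (specialMatrix 𝒜 x B n v p) : 𝒜 n) := by
  have h := congrArg (evalPoint A v) (genericForm_mul_basis 𝒜 d x B hx hn p.1 p.2)
  simp only [map_mul, map_sum, evalPoint_genericForm, evalPoint_C, evalPoint_coeffHom] at h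
  rw [h, Module.Basis.equivFun_symm_apply, AddSubmonoidClass.coe_finsetSum]
  exact Finset.sum_congr rfl fun b _ => by
    rw [Submodule.coe_smul, Algebra.smul_def]
    rfl

/-- The rows of the specialized matrix span the degree `n` part of the specialized ideal. -/
theorem mem_specialIdeal_iff (hx : ∀ j, x j ∈ 𝒜 1) {n : ℕ} (hn : 1 ≤ n)
    (v : Fin d × Fin m → k) (a : 𝒜 n) :
    (a : A) ∈ specialIdeal x v ↔
      (B n).equivFun a ∈ Submodule.span k (Set.range (specialMatrix 𝒜 x B n v)) := by
  obtain ⟨n, rfl⟩ := Nat.exists_eq_add_of_le' hn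
  constructor
  · intro ha
    obtain ⟨b, hb, hab⟩ := exists_eq_sum_mul_of_mem_span 𝒜 (specialForm_mem 𝒜 x hx v) a.2 ha
    have key : ∀ i, ∀ c : 𝒜 n, ∃ w ∈ Submodule.span k (Set.range (specialMatrix 𝒜 x B (n + 1) v)),
        (((B (n + 1)).equivFun.symm w : 𝒜 (n + 1)) : A) = specialForm x v i * c := by
      intro i c
      refine ⟨∑ f, (B n).repr c f • specialMatrix 𝒜 x B (n + 1) v (i, f),
        Submodule.sum_mem _ fun f _ => Submodule.smul_mem _ _ (Submodule.subset_span ⟨_, rfl⟩), ?_⟩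
      conv_rhs => rw [← (B n).sum_repr c]
      rw [map_sum, AddSubmonoidClass.coe_finsetSum, AddSubmonoidClass.coe_finsetSum,
        Finset.mul_sum]
      refine Finset.sum_congr rfl fun f _ => ?_
      rw [map_smul, Submodule.coe_smul, Submodule.coe_smul, mul_smul_comm]
      exact congrArg _ (specialForm_mul_basis 𝒜 x B hx hn v (i, f)).symm
    choose w hw hwe using fun i => key i ⟨b i, hb i⟩
    have : (B (n + 1)).equivFun a = ∑ i, w i := by
      rw [← LinearEquiv.eq_symm_apply]
      apply Subtype.ext
      rw [hab, map_sum, AddSubmonoidClass.coe_finsetSum]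
      exact Finset.sum_congr rfl fun i _ => (hwe i).symm
    rw [this]
    exact Submodule.sum_mem _ fun i _ => hw i
  · intro ha
    have hle : Submodule.span k (Set.range (specialMatrix 𝒜 x B (n + 1) v)) ≤
        ((specialIdeal x v).restrictScalars k).comap
          ((𝒜 (n + 1)).subtype ∘ₗ (B (n + 1)).equivFun.symm.toLinearMap) := by
      refine Submodule.span_le.2 (Set.range_subset_iff.2 fun p => ?_)
      have h := specialForm_mul_basis 𝒜 x B hx hn v p
      change (((B (n + 1)).equivFun.symm (specialMatrix 𝒜 x B (n + 1) v p) : 𝒜 (n + 1)) : A) ∈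
        specialIdeal x v
      rw [← h]
      exact Ideal.mul_mem_right _ _ (Ideal.subset_span ⟨p.1, rfl⟩)
    have h := hle ha
    change (((B (n + 1)).equivFun.symm ((B (n + 1)).equivFun a) : 𝒜 (n + 1)) : A) ∈
      specialIdeal x v at h
    rwa [LinearEquiv.symm_apply_apply] at h

theorem rank_specialMatrix_lt_iff (hx : ∀ j, x j ∈ 𝒜 1) {n : ℕ} (hn : 1 ≤ n)
    (v : Fin d × Fin m → k) :
    (specialMatrix 𝒜 x B n v).rank < Module.finrank k (𝒜 n) ↔
      ¬ ∀ a ∈ 𝒜 n, a ∈ specialIdeal x v := by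
  have htop : (specialMatrix 𝒜 x B n v).rank = Module.finrank k (𝒜 n) ↔
      Submodule.span k (Set.range (specialMatrix 𝒜 x B n v)) = ⊤ := by
    rw [Matrix.rank_eq_finrank_span_row]
    refine ⟨fun h => Submodule.eq_top_of_finrank_eq (h.trans (by simp)), fun h => ?_⟩
    rw [show Set.range (specialMatrix 𝒜 x B n v).row = Set.range (specialMatrix 𝒜 x B n v) from rfl,
      h]
    simp
  have hle := (specialMatrix 𝒜 x B n v).rank_le_card_width
  rw [Fintype.card_fin] at hle
  rw [lt_iff_le_and_ne, and_iff_right hle, Ne, htop, not_iff_not, eq_top_iff]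
  constructor
  · exact fun h a ha => (mem_specialIdeal_iff 𝒜 x B hx hn v ⟨a, ha⟩).2 (h trivial)
  · intro h w _
    have := (mem_specialIdeal_iff 𝒜 x B hx hn v _).1 (h _ ((B n).equivFun.symm w).2)
    rwa [LinearEquiv.apply_symm_apply] at this

theorem mk_mem_degenLocus_iff [Nontrivial A] (hx : ∀ j, x j ∈ 𝒜 1) (n : ℕ)
    {v : Fin d × Fin m → k} (hv : v ≠ 0) :
    Projectivization.mk k v hv ∈ degenLocus 𝒜 d x B n ↔ ¬ ∀ a ∈ 𝒜 n, a ∈ specialIdeal x v := by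
  rw [degenLocus, mk_mem_minorLocus_iff]
  rcases Nat.eq_zero_or_pos n with rfl | hn
  -- In degree `0` both sides are true: the zero matrix has rank below `h_0 > 0`, and `1` is not in
  -- `Q_v`.
  · have h0 : specialMatrix 𝒜 x B 0 v = 0 := by
      ext p b
      rw [specialMatrix, Matrix.map_apply, coeffMatrix]
      refine (map_sum _ _ _).trans (Finset.sum_eq_zero fun j _ => ?_)
      have hz : decompose 𝒜 (x j * (B (0 - 1) p.2 : A)) 0 = 0 := Subtype.ext
        (decompose_of_mem_ne 𝒜 (SetLike.mul_mem_graded (hx j) (B (0 - 1) p.2).2) (by simp))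
      rw [hz]
      simp
    have hone : (1 : A) ∈ 𝒜 0 := SetLike.GradedOne.one_mem
    have : Module.Finite k (𝒜 0) := Module.Finite.of_basis (B 0)
    have hnt : Nontrivial (𝒜 0) := ⟨⟨1, hone⟩, 0, fun h => one_ne_zero (congrArg Subtype.val h)⟩
    rw [h0, Matrix.rank_zero]
    refine iff_of_true Module.finrank_pos fun h => one_ne_zero (α := A) ?_
    exact eq_zero_of_mem_span_of_mem_zero 𝒜 (Set.range_subset_iff.2 (specialForm_mem 𝒜 x hx v))
      hone (h 1 hone)
  · exact rank_specialMatrix_lt_iff 𝒜 x B hx hn v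

end Specialization

/-! ### Minimal reductions as specializations of `Q_u`. -/

section Reductions

variable {k A : Type*} [Field k] [Infinite k] [CommRing A] [Algebra k A]
  {𝒜 : ℕ → Submodule k A} [GradedAlgebra 𝒜] {d m : ℕ} {x : Fin m → A}

theorem IsStandardGraded.not_isReduction_bot (hA : IsStandardGraded 𝒜)
    (hd : ringKrullDim A = d) (hd_pos : 0 < d) : ¬ IsReduction 𝒜 (⊥ : Ideal A) := by
  intro h
  have := hA.nontrivial
  obtain ⟨y, -, hy, hind, -⟩ := hA.exists_algebraicIndependent hd h
  exact hind.ne_zero ⟨0, hd_pos⟩ (hy _)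

theorem IsStandardGraded.exists_mem_ne_zero (hA : IsStandardGraded 𝒜)
    (hd : ringKrullDim A = d) (hd_pos : 0 < d) (n : ℕ) : ∃ a ∈ 𝒜 n, a ≠ 0 := by
  by_contra! h
  exact hA.not_isReduction_bot hd hd_pos (Ideal.span_empty (α := A) ▸
    hA.isReduction_span (Set.empty_subset _) (n := n) fun a ha => h a ha ▸ zero_mem _)

theorem IsStandardGraded.ne_zero_of_isReduction (hA : IsStandardGraded 𝒜)
    (hd : ringKrullDim A = d) (hd_pos : 0 < d) {v : Fin d × Fin m → k}
    (h : IsReduction 𝒜 (specialIdeal x v)) : v ≠ 0 := by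
  rintro rfl
  exact hA.not_isReduction_bot hd hd_pos (specialIdeal_zero (k := k) (d := d) x ▸ h)

/-- The minimal reductions are the reductions generated by `d` linear forms. -/
theorem IsStandardGraded.isMinimalReduction_iff (hA : IsStandardGraded 𝒜)
    (hd : ringKrullDim A = d) (hx : Submodule.span k (Set.range x) = 𝒜 1) {Q : Ideal A} :
    IsMinimalReduction 𝒜 Q ↔
      IsReduction 𝒜 Q ∧ ∃ v : Fin d × Fin m → k, Q = specialIdeal x v := by
  have hx1 : ∀ j, x j ∈ 𝒜 1 := fun j => hx ▸ Submodule.subset_span ⟨j, rfl⟩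
  constructor
  · intro hQ
    obtain ⟨y, hy, hyQ, -, hred⟩ := hA.exists_algebraicIndependent hd hQ.prop
    obtain ⟨v, rfl⟩ := exists_specialForm_eq hx hy
    exact ⟨hQ.prop, v, le_antisymm (hQ.le_of_le hred (Ideal.span_le.2
      (Set.range_subset_iff.2 hyQ))) (Ideal.span_le.2 (Set.range_subset_iff.2 hyQ))⟩
  · rintro ⟨hQ, v, rfl⟩
    refine ⟨hQ, fun Q' hQ' hle => ?_⟩
    obtain ⟨y, hy, hyQ, hind, -⟩ := hA.exists_algebraicIndependent hd hQ'
    -- The `d` independent forms in `Q'` are `k`-combinations of the `d` generators of `Q_v`, since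
    -- the coefficients have degree `0`; so both families span the same space.
    have hyspan : Submodule.span k (Set.range y) ≤
        Submodule.span k (Set.range (specialForm x v)) := by
      refine Submodule.span_le.2 (Set.range_subset_iff.2 fun i => ?_)
      obtain ⟨b, hb, hyb⟩ := exists_eq_sum_mul_of_mem_span 𝒜 (specialForm_mem 𝒜 x hx1 v) (hy i)
        (hle (hyQ i))
      rw [hyb]
      refine Submodule.sum_mem _ fun j _ => ?_
      obtain ⟨c, hc⟩ := Submodule.mem_one.1 (hA.degree_zero ▸ hb j)
      rw [← hc, mul_comm, ← Algebra.smul_def]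
      exact Submodule.smul_mem _ _ (Submodule.subset_span ⟨j, rfl⟩)
    have := FiniteDimensional.span_of_finite k (Set.finite_range (specialForm x v))
    have heq := Submodule.eq_of_le_of_finrank_le hyspan (by
      rw [finrank_span_eq_card hind.linearIndependent]
      exact finrank_range_le_card _)
    refine Ideal.span_le.2 (Set.range_subset_iff.2 fun i => ?_)
    have hmem : specialForm x v i ∈ Submodule.span k (Set.range y) :=
      heq ▸ Submodule.subset_span ⟨i, rfl⟩
    exact (Submodule.span_le.2 (Set.range_subset_iff.2 hyQ) : _ ≤ Q'.restrictScalars k) hmem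

theorem IsStandardGraded.exists_isReduction_specialIdeal (hA : IsStandardGraded 𝒜)
    (hd : ringKrullDim A = d) (hx : Submodule.span k (Set.range x) = 𝒜 1) :
    ∃ v : Fin d × Fin m → k, IsReduction 𝒜 (specialIdeal x v) := by
  have hred : IsReduction 𝒜 (Ideal.span (𝒜 1 : Set A)) :=
    hA.isReduction_span le_rfl (n := 1) fun a ha => Ideal.subset_span ha
  obtain ⟨y, hy, -, -, hy'⟩ := hA.exists_algebraicIndependent hd hred
  obtain ⟨v, rfl⟩ := exists_specialForm_eq hx hy
  exact ⟨v, hy'⟩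

theorem IsStandardGraded.mem_gradedCore_iff (hA : IsStandardGraded 𝒜)
    (hd : ringKrullDim A = d) (hx : Submodule.span k (Set.range x) = 𝒜 1) {a : A} :
    a ∈ gradedCore 𝒜 ↔ ∀ v : Fin d × Fin m → k, IsReduction 𝒜 (specialIdeal x v) →
      a ∈ specialIdeal x v := by
  rw [gradedCore, Submodule.mem_sInf]
  constructor
  · exact fun h v hv => h _ ((hA.isMinimalReduction_iff hd hx).2 ⟨hv, v, rfl⟩)
  · intro h Q hQ
    obtain ⟨hred, v, rfl⟩ := (hA.isMinimalReduction_iff hd hx).1 hQ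
    exact h v hred

variable (B : ∀ n, Module.Basis (Fin (Module.finrank k (𝒜 n))) k (𝒜 n))

/-- Needed because admissible sequences have positive entries. If the rank were `0`, the generators
of `Q_v` would kill `A_{n-1}` and all later degrees, so `A` would vanish in large degrees,
contradicting `d > 0`. -/
theorem IsStandardGraded.rank_specialMatrix_pos (hA : IsStandardGraded 𝒜)
    (hd : ringKrullDim A = d) (hd_pos : 0 < d) (hx : ∀ j, x j ∈ 𝒜 1)
    {v : Fin d × Fin m → k} (hv : IsReduction 𝒜 (specialIdeal x v)) {n : ℕ} (hn : 1 ≤ n) :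
    0 < (specialMatrix 𝒜 x B n v).rank := by
  by_contra! h0
  have hrow : Submodule.span k (Set.range (specialMatrix 𝒜 x B n v)) = ⊥ := by
    rw [← Submodule.finrank_eq_zero (R := k), ← Nat.le_zero]
    exact (Matrix.rank_eq_finrank_span_row _).symm.trans_le h0
  obtain ⟨n, rfl⟩ := Nat.exists_eq_add_of_le' hn
  have hmul : ∀ i, ∀ b ∈ 𝒜 n, specialForm x v i * b = 0 := by
    intro i b hb
    have hmem : specialForm x v i * b ∈ 𝒜 (n + 1) :=
      mul_comm b _ ▸ SetLike.mul_mem_graded hb (specialForm_mem 𝒜 x hx v i)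
    have h := (mem_specialIdeal_iff 𝒜 x B hx hn v ⟨_, hmem⟩).1
      (Ideal.mul_mem_right _ _ (Ideal.subset_span ⟨i, rfl⟩))
    rw [hrow, Submodule.mem_bot, LinearEquiv.map_eq_zero_iff] at h
    exact congrArg Subtype.val h
  obtain ⟨N, hN⟩ := hv.2
  obtain ⟨a, ha, ha0⟩ := hA.exists_mem_ne_zero hd hd_pos (max N n + 1)
  obtain ⟨b, hb, rfl⟩ := exists_eq_sum_mul_of_mem_span 𝒜 (specialForm_mem 𝒜 x hx v) ha
    (hN _ (by omega) a ha)
  refine ha0 (Finset.sum_eq_zero fun i _ => ?_)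
  -- Here `le_of_le` is applied to the annihilator of a generator.
  exact hA.le_of_le (Q := LinearMap.ker (LinearMap.mulLeft A (specialForm x v i)))
    (le_max_right N n) (hmul i) _ (hb i)

end Reductions

/-! ### Cramer's rule modulo `Q_u`. -/

section Cramer

variable {k A : Type*} [Field k] [CommRing A] [Algebra k A] {d m : ℕ}
  (𝒜 : ℕ → Submodule k A) [GradedAlgebra 𝒜] (x : Fin m → A)
  (B : ∀ n, Module.Basis (Fin (Module.finrank k (𝒜 n))) k (𝒜 n))

/-- The minor of `M_n` with rows `p` and columns `q`, bordered by the coefficients of `a` and by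
the column `c`. -/
noncomputable def borderedMinor {n t : ℕ} (a : 𝒜 n)
    (p : Fin t → Fin d × Fin (Module.finrank k (𝒜 (n - 1))))
    (q : Fin t → Fin (Module.finrank k (𝒜 n))) (c : Fin (Module.finrank k (𝒜 n))) :
    MvPolynomial (Fin d × Fin m) k :=
  (borderedMatrix (coeffMatrix 𝒜 d x B n) (fun b => MvPolynomial.C ((B n).repr a b)) p q c).det

/-- Modulo `Q_u`, a minor of `M_n` multiplies `a ∈ A_n` into the ideal generated by the bordered
minors. -/
theorem mul_minor_sub_sum_mem (hx : ∀ j, x j ∈ 𝒜 1) {n t : ℕ} (hn : 1 ≤ n) (a : 𝒜 n)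
    (p : Fin t → Fin d × Fin (Module.finrank k (𝒜 (n - 1))))
    (q : Fin t → Fin (Module.finrank k (𝒜 n))) :
    MvPolynomial.C (a : A) * coeffHom k A _ ((coeffMatrix 𝒜 d x B n).submatrix p q).det -
        ∑ c, coeffHom k A _ (borderedMinor 𝒜 x B a p q c) * MvPolynomial.C (B n c : A) ∈
      genericReduction d x := by
  obtain ⟨l, hl⟩ := exists_minor_mul_eq (coeffMatrix 𝒜 d x B n)
    (fun b => MvPolynomial.C ((B n).repr a b)) p q
  have ha : (MvPolynomial.C (a : A) : MvPolynomial (Fin d × Fin m) A) =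
      ∑ c, coeffHom k A _ (MvPolynomial.C ((B n).repr a c)) * MvPolynomial.C (B n c : A) := by
    conv_lhs => rw [← (B n).sum_repr a]
    rw [AddSubmonoidClass.coe_finsetSum, map_sum]
    refine Finset.sum_congr rfl fun c _ => ?_
    rw [Submodule.coe_smul, Algebra.smul_def, map_mul, coeffHom, MvPolynomial.map_C]
  have key : MvPolynomial.C (a : A) *
        coeffHom k A _ ((coeffMatrix 𝒜 d x B n).submatrix p q).det -
        ∑ c, coeffHom k A _ (borderedMinor 𝒜 x B a p q c) * MvPolynomial.C (B n c : A) =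
      ∑ i, coeffHom k A _ (l i) *
        (genericForm d x (p i).1 * MvPolynomial.C (B (n - 1) (p i).2 : A)) := by
    rw [ha, Finset.sum_mul, ← Finset.sum_sub_distrib]
    simp_rw [genericForm_mul_basis 𝒜 d x B hx hn, Finset.mul_sum]
    rw [Finset.sum_comm]
    refine Finset.sum_congr rfl fun c _ => ?_
    have h := congrArg (coeffHom k A _) (hl c)
    rw [map_mul, map_add, map_sum] at h
    simp_rw [← mul_assoc, ← Finset.sum_mul, ← map_mul]
    simp only [Prod.mk.eta, borderedMinor]
    linear_combination MvPolynomial.C (B n c : A) * h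
  rw [key]
  exact Ideal.sum_mem _ fun i _ => Ideal.mul_mem_left _ _
    (Ideal.mul_mem_right _ _ (Ideal.subset_span ⟨_, rfl⟩))

/-- Cramer's rule: the maximal minors of `M_n` multiply `A_n` into `Q_u`. -/
theorem coeffHom_mul_C_mem_of_maximal (hx : ∀ j, x j ∈ 𝒜 1) {n : ℕ} (hn : 1 ≤ n) {a : A}
    (ha : a ∈ 𝒜 n) {f : MvPolynomial (Fin d × Fin m) k}
    (hf : f ∈ coeffMinors 𝒜 d x B n (Module.finrank k (𝒜 n))) :
    coeffHom k A _ f * MvPolynomial.C a ∈ genericReduction d x := by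
  have h : coeffMinors 𝒜 d x B n (Module.finrank k (𝒜 n)) ≤
      ((genericReduction d x).colon {MvPolynomial.C a}).comap (coeffHom k A _) := by
    refine Ideal.span_le.2 ?_
    rintro _ ⟨p, q, rfl⟩
    rw [SetLike.mem_coe, Ideal.mem_comap, Submodule.mem_colon_singleton, smul_eq_mul, mul_comm]
    have h := mul_minor_sub_sum_mem 𝒜 x B hx hn ⟨a, ha⟩ p q
    rwa [Finset.sum_eq_zero, sub_zero] at h
    intro c _
    rw [borderedMinor, det_borderedMatrix_eq_zero_of_card _ _ _ _ _ (by simp), map_zero, zero_mul]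
  simpa [Submodule.mem_colon_singleton] using h hf

theorem IsStandardGraded.coeffHom_mul_C_mem {𝒜 : ℕ → Submodule k A} [GradedAlgebra 𝒜]
    (B : ∀ n, Module.Basis (Fin (Module.finrank k (𝒜 n))) k (𝒜 n))
    (hA : IsStandardGraded 𝒜) (hx : ∀ j, x j ∈ 𝒜 1) {n l : ℕ} (hn : 1 ≤ n) (hnl : n ≤ l) {a : A}
    (ha : a ∈ 𝒜 l) {f : MvPolynomial (Fin d × Fin m) k}
    (hf : f ∈ coeffMinors 𝒜 d x B n (Module.finrank k (𝒜 n))) :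
    coeffHom k A _ f * MvPolynomial.C a ∈ genericReduction d x := by
  have h := hA.le_of_le (Q := ((genericReduction d x).colon {coeffHom k A _ f}).comap
    MvPolynomial.C) hnl (fun b hb => by
      rw [Ideal.mem_comap, Submodule.mem_colon_singleton, smul_eq_mul, mul_comm]
      exact coeffHom_mul_C_mem_of_maximal 𝒜 x B hx hn hb hf) a ha
  rwa [Ideal.mem_comap, Submodule.mem_colon_singleton, smul_eq_mul, mul_comm] at h

end Cramer

/-! ### The chain of degeneracy loci. -/

section Loci

variable {k A : Type*} [Field k] [CommRing A] [Algebra k A]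
  {𝒜 : ℕ → Submodule k A} [GradedAlgebra 𝒜] {d m : ℕ} {x : Fin m → A}
  (B : ∀ n, Module.Basis (Fin (Module.finrank k (𝒜 n))) k (𝒜 n))

theorem forall_mem_coeffMinors_eval_eq_zero_iff (hx : ∀ j, x j ∈ 𝒜 1) {n : ℕ} (hn : 1 ≤ n)
    (v : Fin d × Fin m → k) :
    (∀ f ∈ coeffMinors 𝒜 d x B n (Module.finrank k (𝒜 n)), MvPolynomial.eval v f = 0) ↔
      ¬ ∀ a ∈ 𝒜 n, a ∈ specialIdeal x v := by
  rw [← rank_specialMatrix_lt_iff 𝒜 x B hx hn]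
  exact forall_mem_minorIdeal_eval_eq_zero_iff _ _ _

theorem IsStandardGraded.antitone_degenLocus (hA : IsStandardGraded 𝒜) (hx : ∀ j, x j ∈ 𝒜 1) :
    Antitone (degenLocus 𝒜 d x B) := by
  have := hA.nontrivial
  intro n l hnl α
  induction α using Projectivization.ind with
  | h v hv =>
    rw [mk_mem_degenLocus_iff 𝒜 x B hx, mk_mem_degenLocus_iff 𝒜 x B hx]
    exact mt (hA.le_of_le hnl)

theorem IsStandardGraded.exists_degenLocus_eq (hA : IsStandardGraded 𝒜) (hx : ∀ j, x j ∈ 𝒜 1) :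
    ∃ N, ∀ n, N ≤ n → degenLocus 𝒜 d x B n = degenLocus 𝒜 d x B N := by
  have := hA.nontrivial
  -- The affine cones over the `V_n` decrease, so their vanishing ideals increase and stabilize. For
  -- `n ≥ 1` the cone is cut out by maximal minors and is recovered from its vanishing ideal.
  let W : ℕ → Set (Fin d × Fin m → k) := fun n => {v | ¬ ∀ a ∈ 𝒜 n, a ∈ specialIdeal x v}
  have hW : Antitone W := fun n l hnl v => mt (hA.le_of_le hnl)
  obtain ⟨N, hN⟩ := monotone_stabilizes_iff_noetherian.2
    (inferInstance : IsNoetherian (MvPolynomial (Fin d × Fin m) k)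
      (MvPolynomial (Fin d × Fin m) k))
    ⟨fun n => MvPolynomial.vanishingIdeal k (W n),
      fun n l hnl => MvPolynomial.vanishingIdeal_anti_mono (hW hnl)⟩
  refine ⟨N, fun n hn => le_antisymm (hA.antitone_degenLocus B hx hn) fun α => ?_⟩
  -- The description by minors needs `n ≥ 1`, which strict inequality `N < n` guarantees.
  rcases hn.eq_or_lt with rfl | hlt
  · exact id
  have heq : MvPolynomial.vanishingIdeal k (W N) = MvPolynomial.vanishingIdeal k (W n) := hN n hn
  induction α using Projectivization.ind with
  | h v hv =>
    rw [mk_mem_degenLocus_iff 𝒜 x B hx, mk_mem_degenLocus_iff 𝒜 x B hx]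
    intro hv'
    rw [← forall_mem_coeffMinors_eval_eq_zero_iff B hx (by omega)]
    intro f hf
    have hfn : f ∈ MvPolynomial.vanishingIdeal k (W n) := by
      intro w hw
      rw [MvPolynomial.aeval_eq_eval]
      exact (forall_mem_coeffMinors_eval_eq_zero_iff B hx (by omega) w).2 hw f hf
    rw [← heq] at hfn
    have := hfn v hv'
    rwa [MvPolynomial.aeval_eq_eval] at this

end Loci

/-! ### The last jump of the loci and the big reduction number. -/

section ReductionNumber

variable {k A : Type*} [Field k] [Infinite k] [CommRing A] [Algebra k A]
  {𝒜 : ℕ → Submodule k A} [GradedAlgebra 𝒜] {d m : ℕ} {x : Fin m → A}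
  (B : ∀ n, Module.Basis (Fin (Module.finrank k (𝒜 n))) k (𝒜 n))

/-- There is a largest `r` with `V_r ≠ V_{r+1}`. -/
theorem IsStandardGraded.exists_isGreatest (hA : IsStandardGraded 𝒜)
    (hd : ringKrullDim A = d) (hd_pos : 0 < d) (hx : Submodule.span k (Set.range x) = 𝒜 1) :
    ∃ r, IsGreatest {n : ℕ | degenLocus 𝒜 d x B n ≠ degenLocus 𝒜 d x B (n + 1)} r := by
  have := hA.nontrivial
  have hx1 : ∀ j, x j ∈ 𝒜 1 := fun j => hx ▸ Submodule.subset_span ⟨j, rfl⟩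
  obtain ⟨N, hN⟩ := hA.exists_degenLocus_eq (d := d) B hx1
  have hbdd : BddAbove {n : ℕ | degenLocus 𝒜 d x B n ≠ degenLocus 𝒜 d x B (n + 1)} := by
    refine ⟨N, fun n hn => ?_⟩
    by_contra! h
    exact hn (by rw [hN n h.le, hN (n + 1) (by omega)])
  refine ⟨_, Nat.sSup_mem ?_ hbdd, fun n hn => le_csSup hbdd hn⟩
  by_contra! hempty
  obtain ⟨v, hv⟩ := hA.exists_isReduction_specialIdeal hd hx
  have hv0 := hA.ne_zero_of_isReduction hd hd_pos hv
  obtain ⟨n₀, hn₀⟩ := hv.2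
  -- Without jumps every `V_n` would be the whole space `V_0`, yet the point of a reduction leaves
  -- `V_n` for large `n`.
  have hall : ∀ n, degenLocus 𝒜 d x B n = degenLocus 𝒜 d x B 0 := by
    intro n
    induction n with
    | zero => rfl
    | succ n ih =>
      rw [← ih]
      by_contra hne
      exact (Set.eq_empty_iff_forall_notMem.1 hempty n) (Ne.symm hne)
  have h0 : Projectivization.mk k v hv0 ∈ degenLocus 𝒜 d x B 0 := by
    rw [mk_mem_degenLocus_iff 𝒜 x B hx1]
    intro h
    have hone : (1 : A) ∈ 𝒜 0 := SetLike.GradedOne.one_mem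
    exact one_ne_zero (eq_zero_of_mem_span_of_mem_zero 𝒜
      (Set.range_subset_iff.2 (specialForm_mem 𝒜 x hx1 v)) hone (h 1 hone))
  rw [← hall n₀, mk_mem_degenLocus_iff 𝒜 x B hx1] at h0
  exact h0 (hn₀ n₀ le_rfl)

variable {B} {r : ℕ}

/-- The loci are constant from `V_{r+1}` on, so a point outside some `V_n` with `n` large is already
outside `V_{r+1}`. -/
theorem IsStandardGraded.mem_specialIdeal_of_isGreatest (hA : IsStandardGraded 𝒜)
    (hd : ringKrullDim A = d) (hd_pos : 0 < d) (hx : ∀ j, x j ∈ 𝒜 1)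
    (hr : IsGreatest {n : ℕ | degenLocus 𝒜 d x B n ≠ degenLocus 𝒜 d x B (n + 1)} r)
    {v : Fin d × Fin m → k} (hv : IsReduction 𝒜 (specialIdeal x v)) :
    ∀ a ∈ 𝒜 (r + 1), a ∈ specialIdeal x v := by
  have := hA.nontrivial
  have hv0 := hA.ne_zero_of_isReduction hd hd_pos hv
  obtain ⟨n₀, hn₀⟩ := hv.2
  have hall : ∀ n, r + 1 ≤ n → degenLocus 𝒜 d x B n = degenLocus 𝒜 d x B (r + 1) := by
    intro n hn
    induction n, hn using Nat.le_induction with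
    | base => rfl
    | succ n hn ih =>
      rw [← ih]
      by_contra hne
      have : n ≤ r := hr.2 (Ne.symm hne)
      omega
  by_contra h
  rw [← mk_mem_degenLocus_iff 𝒜 x B hx _ hv0, ← hall (max (r + 1) n₀) (le_max_left _ _),
    mk_mem_degenLocus_iff 𝒜 x B hx] at h
  exact h (hn₀ _ (le_max_right _ _))

theorem IsStandardGraded.bigReductionNumber_eq (hA : IsStandardGraded 𝒜)
    (hd : ringKrullDim A = d) (hd_pos : 0 < d) (hx : Submodule.span k (Set.range x) = 𝒜 1)
    (hr : IsGreatest {n : ℕ | degenLocus 𝒜 d x B n ≠ degenLocus 𝒜 d x B (n + 1)} r) :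
    bigReductionNumber 𝒜 = r := by
  have := hA.nontrivial
  have hx1 : ∀ j, x j ∈ 𝒜 1 := fun j => hx ▸ Submodule.subset_span ⟨j, rfl⟩
  apply le_antisymm
  · refine iSup₂_le fun Q hQ => iSup₂_le fun n hn => ?_
    obtain ⟨hred, v, rfl⟩ := (hA.isMinimalReduction_iff hd hx).1 hQ
    obtain ⟨a, ha, haQ⟩ := hn
    by_contra hlt
    have hle : r + 1 ≤ n := by
      by_contra h
      exact hlt (by exact_mod_cast (by omega : n ≤ r))
    exact haQ (hA.le_of_le hle (hA.mem_specialIdeal_of_isGreatest hd hd_pos hx1 hr hred) a ha)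
  · have hssub : ∃ α ∈ degenLocus 𝒜 d x B r, α ∉ degenLocus 𝒜 d x B (r + 1) := by
      by_contra! h
      exact hr.1 (le_antisymm h (hA.antitone_degenLocus B hx1 r.le_succ))
    obtain ⟨α, hα, hα'⟩ := hssub
    induction α using Projectivization.ind with
    | h v hv =>
      rw [mk_mem_degenLocus_iff 𝒜 x B hx1] at hα hα'
      rw [not_not] at hα'
      push Not at hα
      exact le_iSup₂_of_le (specialIdeal x v) ((hA.isMinimalReduction_iff hd hx).2
        ⟨hA.isReduction_specialIdeal hx1 hα', v, rfl⟩) (le_iSup₂_of_le r hα le_rfl)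

end ReductionNumber

/-! ### The ideals attached to a sequence `a`. -/

section Strata

variable {k A : Type*} [Field k] [CommRing A] [Algebra k A]
  {𝒜 : ℕ → Submodule k A} [GradedAlgebra 𝒜] {d m : ℕ} {x : Fin m → A}
  {B : ∀ n, Module.Basis (Fin (Module.finrank k (𝒜 n))) k (𝒜 n)} {r : ℕ}

variable (𝒜 d x B) in
/-- The ideal `Q_u + ∑ √I_{a_n+1}(M_n)` of `A[u]`. -/
noncomputable def stratumIdeal (r : ℕ) (a : Fin r → ℕ) : Ideal (MvPolynomial (Fin d × Fin m) A) :=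
  genericReduction d x +
    ∑ i : Fin r, ((coeffMinors 𝒜 d x B (i + 1) (a i + 1)).radical).map
      (coeffHom k A (Fin d × Fin m))

variable (𝒜 d x B) in
/-- The ideal `J ∏ I_{a_n}(M_n)` of `k[u]`. -/
noncomputable def stratumOpenIdeal (r : ℕ) (a : Fin r → ℕ) :
    Ideal (MvPolynomial (Fin d × Fin m) k) :=
  coeffMinors 𝒜 d x B (r + 1) (Module.finrank k (𝒜 (r + 1))) *
    ∏ i : Fin r, coeffMinors 𝒜 d x B (i + 1) (a i)

theorem genericReduction_le_stratumIdeal (a : Fin r → ℕ) :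
    genericReduction d x ≤ stratumIdeal 𝒜 d x B r a :=
  le_sup_left

theorem coeffHom_mem_stratumIdeal {a : Fin r → ℕ} (i : Fin r)
    {f : MvPolynomial (Fin d × Fin m) k}
    (hf : f ∈ (coeffMinors 𝒜 d x B (i + 1) (a i + 1)).radical) :
    coeffHom k A _ f ∈ stratumIdeal 𝒜 d x B r a := by
  refine Ideal.mem_sup_right ?_
  rw [Ideal.sum_eq_sup]
  exact Finset.le_sup (f := fun i : Fin r =>
    ((coeffMinors 𝒜 d x B (i + 1) (a i + 1)).radical).map (coeffHom k A (Fin d × Fin m)))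
    (Finset.mem_univ i) (Ideal.mem_map_of_mem _ hf)

/-- On the locus where the ranks of the `M_n(v)` are at most the `a_n`, the ideal
`Q_u + ∑ √I_{a_n+1}(M_n)` specializes into `Q_v`. -/
theorem evalPoint_mem_of_mem_stratumIdeal {a : Fin r → ℕ} {v : Fin d × Fin m → k}
    (hv : ∀ i : Fin r, (specialMatrix 𝒜 x B (i + 1) v).rank ≤ a i)
    {f : MvPolynomial (Fin d × Fin m) A} (hf : f ∈ stratumIdeal 𝒜 d x B r a) :
    evalPoint A v f ∈ specialIdeal x v := by
  have h : stratumIdeal 𝒜 d x B r a ≤ (specialIdeal x v).comap (evalPoint A v) := by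
    refine sup_le (fun f hf => evalPoint_mem_of_mem_genericReduction x v hf) ?_
    rw [Ideal.sum_eq_sup]
    refine Finset.sup_le fun i _ => Ideal.map_le_iff_le_comap.2 fun g hg => ?_
    obtain ⟨e, he⟩ := hg
    have h0 := (forall_mem_minorIdeal_eval_eq_zero_iff (coeffMatrix 𝒜 d x B (i + 1)) (a i + 1) v).2
      (Nat.lt_succ_of_le (hv i)) _ he
    rw [map_pow] at h0
    rw [Ideal.mem_comap, Ideal.mem_comap, evalPoint_coeffHom, eq_zero_of_pow_eq_zero h0, map_zero]
    exact zero_mem _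
  exact h hf

theorem stratumOpenIdeal_le_left (a : Fin r → ℕ) : stratumOpenIdeal 𝒜 d x B r a ≤
    coeffMinors 𝒜 d x B (r + 1) (Module.finrank k (𝒜 (r + 1))) :=
  Ideal.mul_le_left

theorem stratumOpenIdeal_le_mul (a : Fin r → ℕ) (i : Fin r) : stratumOpenIdeal 𝒜 d x B r a ≤
    coeffMinors 𝒜 d x B (r + 1) (Module.finrank k (𝒜 (r + 1))) *
      coeffMinors 𝒜 d x B (i + 1) (a i) := by
  rw [stratumOpenIdeal]
  refine Ideal.mul_mono_right (Ideal.prod_le_inf.trans ?_)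
  exact Finset.inf_le (f := fun i : Fin r => coeffMinors 𝒜 d x B (i + 1) (a i)) (Finset.mem_univ i)

/-- The polynomials vanishing at `v` form a prime ideal, which contains a product of ideals only if
it contains a factor. -/
theorem exists_mem_stratumOpenIdeal_eval_ne_zero (hx : ∀ j, x j ∈ 𝒜 1) {a : Fin r → ℕ}
    {v : Fin d × Fin m → k}
    (hv : ∀ i : Fin r, a i ≤ (specialMatrix 𝒜 x B (i + 1) v).rank)
    (hr : ∀ a ∈ 𝒜 (r + 1), a ∈ specialIdeal x v) :
    ∃ g ∈ stratumOpenIdeal 𝒜 d x B r a, MvPolynomial.eval v g ≠ 0 := by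
  by_contra! h
  have hle : stratumOpenIdeal 𝒜 d x B r a ≤ RingHom.ker (MvPolynomial.eval v) := h
  have hprime : (RingHom.ker (MvPolynomial.eval v)).IsPrime := RingHom.ker_isPrime _
  rw [stratumOpenIdeal, hprime.mul_le, hprime.prod_le] at hle
  rcases hle with hJ | ⟨i, -, hi⟩
  · exact (forall_mem_coeffMinors_eval_eq_zero_iff B hx (by omega) v).1 (fun f hf => hJ hf) hr
  · exact ((forall_mem_minorIdeal_eval_eq_zero_iff _ _ v).1 fun f hf => hi hf).not_ge (hv i)

end Strata

/-! ### The two inclusions for the core. -/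

section Core

variable {k A : Type*} [Field k] [IsAlgClosed k] [CommRing A] [Algebra k A]
  {𝒜 : ℕ → Submodule k A} [GradedAlgebra 𝒜] {d m : ℕ} {x : Fin m → A}
  {B : ∀ n, Module.Basis (Fin (Module.finrank k (𝒜 n))) k (𝒜 n)} {r : ℕ}

/-- Nullstellensatz: `J` times a bordered minor of `M_n` given by an element of the core lies in
`√I_{t+1}(M_n)`. -/
theorem IsStandardGraded.mul_borderedMinor_mem_radical (hA : IsStandardGraded 𝒜)
    (hx : ∀ j, x j ∈ 𝒜 1) {n t l : ℕ} (hn : 1 ≤ n) (hl : 1 ≤ l) (f : 𝒜 n)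
    (hf : ∀ v : Fin d × Fin m → k, IsReduction 𝒜 (specialIdeal x v) → (f : A) ∈ specialIdeal x v)
    {j : MvPolynomial (Fin d × Fin m) k}
    (hj : j ∈ coeffMinors 𝒜 d x B l (Module.finrank k (𝒜 l)))
    (p : Fin t → Fin d × Fin (Module.finrank k (𝒜 (n - 1))))
    (q : Fin t → Fin (Module.finrank k (𝒜 n))) (c : Fin (Module.finrank k (𝒜 n))) :
    j * borderedMinor 𝒜 x B f p q c ∈ (coeffMinors 𝒜 d x B n (t + 1)).radical := by
  rw [← MvPolynomial.vanishingIdeal_zeroLocus_eq_radical (K := k)]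
  intro v hv
  simp only [MvPolynomial.mem_zeroLocus_iff, MvPolynomial.aeval_eq_eval] at hv
  have hrank := (forall_mem_minorIdeal_eval_eq_zero_iff _ _ v).1 hv
  rw [MvPolynomial.aeval_eq_eval]
  change MvPolynomial.eval v _ = 0
  rw [map_mul]
  -- If `j(v) ≠ 0` then `A_l ⊆ Q_v`, so `Q_v` is a reduction and contains `f`.
  by_cases hjv : MvPolynomial.eval v j = 0
  · rw [hjv, zero_mul]
  have hred : IsReduction 𝒜 (specialIdeal x v) := by
    refine hA.isReduction_specialIdeal hx (n := l) ?_
    by_contra h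
    exact hjv ((forall_mem_coeffMinors_eval_eq_zero_iff B hx hl v).2 h j hj)
  rw [borderedMinor, map_borderedMatrix, det_borderedMatrix_eq_zero, mul_zero]
  · simp only [MvPolynomial.eval_C]
    exact (mem_specialIdeal_iff 𝒜 x B hx hn v f).1 (hf v hred)
  · exact Nat.le_of_lt_succ hrank

/-- Degree `0` is trivial since reductions `Q_v` meet `A_0` in `0`; degrees above `r` need only the
factor `J`; a degree `n` with `1 ≤ n ≤ r` needs only `J` and `I_{a_n}(M_n)`. -/
theorem IsStandardGraded.mul_mem_stratumIdeal (hA : IsStandardGraded 𝒜)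
    (hd : ringKrullDim A = d) (hx : Submodule.span k (Set.range x) = 𝒜 1)
    {n : ℕ} {f : A} (hfn : f ∈ 𝒜 n) (hf : f ∈ gradedCore 𝒜) (a : Fin r → ℕ)
    {g : MvPolynomial (Fin d × Fin m) k} (hg : g ∈ stratumOpenIdeal 𝒜 d x B r a) :
    coeffHom k A _ g * MvPolynomial.C f ∈ stratumIdeal 𝒜 d x B r a := by
  have hx1 : ∀ j, x j ∈ 𝒜 1 := fun j => hx ▸ Submodule.subset_span ⟨j, rfl⟩
  rw [hA.mem_gradedCore_iff hd hx] at hf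
  rcases Nat.eq_zero_or_pos n with rfl | hn
  · obtain ⟨v, hv⟩ := hA.exists_isReduction_specialIdeal hd hx
    rw [eq_zero_of_mem_span_of_mem_zero 𝒜
      (Set.range_subset_iff.2 (specialForm_mem 𝒜 x hx1 v)) hfn (hf v hv), map_zero, mul_zero]
    exact zero_mem _
  rcases lt_or_ge r n with hrn | hnr
  · exact genericReduction_le_stratumIdeal a
      (hA.coeffHom_mul_C_mem x B hx1 (by omega) hrn hfn (stratumOpenIdeal_le_left a hg))
  · obtain ⟨i, rfl⟩ : ∃ i : Fin r, n = i + 1 := ⟨⟨n - 1, by omega⟩, by simp; omega⟩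
    have hmul : coeffMinors 𝒜 d x B (r + 1) (Module.finrank k (𝒜 (r + 1))) *
        coeffMinors 𝒜 d x B (i + 1) (a i) ≤
          ((stratumIdeal 𝒜 d x B r a).colon {MvPolynomial.C f}).comap (coeffHom k A _) := by
      refine Ideal.mul_le.2 fun j hj s hs => ?_
      have hs' : coeffMinors 𝒜 d x B (i + 1) (a i) ≤ ((stratumIdeal 𝒜 d x B r a).colon
          {coeffHom k A _ j * MvPolynomial.C f}).comap (coeffHom k A _) := by
        refine Ideal.span_le.2 ?_
        rintro _ ⟨p, q, rfl⟩
        rw [SetLike.mem_coe, Ideal.mem_comap, Submodule.mem_colon_singleton, smul_eq_mul]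
        -- The first term is `j` times the difference between minor times `f` and its bordered
        -- combination; the second is `j` times that combination, which lies in the extended
        -- radical.
        have h1 := Ideal.mul_mem_left _ (coeffHom k A _ j) (genericReduction_le_stratumIdeal
          (B := B) a (mul_minor_sub_sum_mem 𝒜 x B hx1 hn ⟨f, hfn⟩ p q))
        have h2 : coeffHom k A _ j * ∑ c, coeffHom k A _ (borderedMinor 𝒜 x B ⟨f, hfn⟩ p q c) *
            MvPolynomial.C (B (i + 1) c : A) ∈ stratumIdeal 𝒜 d x B r a := by
          rw [Finset.mul_sum]
          refine Ideal.sum_mem _ fun c _ => ?_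
          rw [← mul_assoc, ← map_mul]
          exact Ideal.mul_mem_right _ _ (coeffHom_mem_stratumIdeal i
            (hA.mul_borderedMinor_mem_radical hx1 hn (by omega) ⟨f, hfn⟩ hf hj p q c))
        convert add_mem h1 h2 using 1
        ring
      have h := hs' hs
      rw [Ideal.mem_comap, Submodule.mem_colon_singleton, smul_eq_mul] at h ⊢
      rwa [map_mul, mul_comm (coeffHom k A _ j), mul_assoc]
    have h := hmul (stratumOpenIdeal_le_mul a i hg)
    rwa [Ideal.mem_comap, Submodule.mem_colon_singleton, smul_eq_mul] at h

theorem IsStandardGraded.gradedCore_le_comap_colon (hA : IsStandardGraded 𝒜)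
    (hd : ringKrullDim A = d) (hx : Submodule.span k (Set.range x) = 𝒜 1) (a : Fin r → ℕ) :
    gradedCore 𝒜 ≤ Ideal.comap MvPolynomial.C
      (Submodule.colon (stratumIdeal 𝒜 d x B r a)
        ((stratumOpenIdeal 𝒜 d x B r a).map (coeffHom k A (Fin d × Fin m)) :
          Set (MvPolynomial (Fin d × Fin m) A))) := by
  have hx1 : ∀ j, x j ∈ 𝒜 1 := fun j => hx ▸ Submodule.subset_span ⟨j, rfl⟩
  intro f hf
  classical
  rw [← sum_support_decompose 𝒜 f]
  refine Ideal.sum_mem _ fun n _ => ?_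
  have hfn : (decompose 𝒜 f n : A) ∈ gradedCore 𝒜 := by
    rw [hA.mem_gradedCore_iff hd hx] at hf ⊢
    exact fun v hv => decompose_mem_span 𝒜
      (Set.range_subset_iff.2 (specialForm_mem 𝒜 x hx1 v)) (hf v hv) n
  rw [Ideal.mem_comap, Submodule.mem_colon]
  intro g hg
  have hle : (stratumOpenIdeal 𝒜 d x B r a).map (coeffHom k A (Fin d × Fin m)) ≤
      (stratumIdeal 𝒜 d x B r a).colon {MvPolynomial.C (decompose 𝒜 f n : A)} := by
    refine Ideal.map_le_iff_le_comap.2 fun s hs => ?_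
    rw [Ideal.mem_comap, Submodule.mem_colon_singleton]
    exact hA.mul_mem_stratumIdeal hd hx (SetLike.coe_mem _) hfn a hs
  rw [smul_eq_mul, mul_comm]
  exact Submodule.mem_colon_singleton.1 (hle hg)

theorem IsStandardGraded.iInf_comap_colon_le_gradedCore (hA : IsStandardGraded 𝒜)
    (hd : ringKrullDim A = d) (hd_pos : 0 < d) (hx : Submodule.span k (Set.range x) = 𝒜 1)
    (hr : IsGreatest {n : ℕ | degenLocus 𝒜 d x B n ≠ degenLocus 𝒜 d x B (n + 1)} r) :
    ⨅ a ∈ admissible 𝒜 d x B r, Ideal.comap MvPolynomial.C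
      (Submodule.colon (stratumIdeal 𝒜 d x B r a)
        ((stratumOpenIdeal 𝒜 d x B r a).map (coeffHom k A (Fin d × Fin m)) :
          Set (MvPolynomial (Fin d × Fin m) A))) ≤ gradedCore 𝒜 := by
  have := hA.nontrivial
  have hx1 : ∀ j, x j ∈ 𝒜 1 := fun j => hx ▸ Submodule.subset_span ⟨j, rfl⟩
  intro f hf
  rw [hA.mem_gradedCore_iff hd hx]
  intro v hv
  have hv0 := hA.ne_zero_of_isReduction hd hd_pos hv
  have hvr := hA.mem_specialIdeal_of_isGreatest hd hd_pos hx1 hr hv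
  -- The sequence of ranks singles out the stratum containing `v`.
  let a : Fin r → ℕ := fun i => (specialMatrix 𝒜 x B (i + 1) v).rank
  have ha : a ∈ admissible 𝒜 d x B r := by
    refine ⟨fun i => hA.rank_specialMatrix_pos B hd hd_pos hx1 hv (by omega),
      Projectivization.mk k v hv0, Set.mem_iInter.2 fun i => ⟨?_, ?_⟩⟩
    · exact (mk_mem_minorLocus_iff 𝒜 x B hv0).2 (Nat.lt_succ_self _)
    · rintro (h | h)
      · exact lt_irrefl _ ((mk_mem_minorLocus_iff 𝒜 x B hv0).1 h)
      · exact (mk_mem_degenLocus_iff 𝒜 x B hx1 _ hv0).1 h hvr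
  obtain ⟨g, hg, hgv⟩ := exists_mem_stratumOpenIdeal_eval_ne_zero (B := B) (a := a) hx1
    (fun _ => le_rfl) hvr
  have hfa := (Submodule.mem_iInf _).1 ((Submodule.mem_iInf _).1 hf a) ha
  rw [Ideal.mem_comap, Submodule.mem_colon] at hfa
  have h := evalPoint_mem_of_mem_stratumIdeal (fun _ => le_rfl)
    (hfa _ (Ideal.mem_map_of_mem _ hg))
  rw [smul_eq_mul, map_mul, evalPoint_C, evalPoint_coeffHom] at h
  exact (Ideal.mul_unit_mem_iff_mem _ ((IsUnit.mk0 _ hgv).map (algebraMap k A))).1 h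

end Core

end GradedCore

open GradedCore in
theorem theorem1p6 {k A : Type*} [Field k] [IsAlgClosed k] [CommRing A] [Algebra k A]
    (𝒜 : ℕ → Submodule k A) [GradedAlgebra 𝒜] (hA : IsStandardGraded 𝒜)
    (d : ℕ) (hd : ringKrullDim A = d) (hd_pos : 0 < d)
    (m : ℕ) (x : Fin m → A) (hx : Submodule.span k (Set.range x) = 𝒜 1)
    (B : ∀ n, Module.Basis (Fin (Module.finrank k (𝒜 n))) k (𝒜 n)) :
    ∃ r : ℕ,
      IsGreatest {n : ℕ | degenLocus 𝒜 d x B n ≠ degenLocus 𝒜 d x B (n + 1)} r ∧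
      bigReductionNumber 𝒜 = r ∧
      gradedCore 𝒜 =
        ⨅ a ∈ admissible 𝒜 d x B r,
          Ideal.comap MvPolynomial.C
            (Submodule.colon
              (genericReduction d x +
                ∑ i : Fin r, ((coeffMinors 𝒜 d x B (i + 1) (a i + 1)).radical).map
                  (coeffHom k A (Fin d × Fin m)))
              ((coeffMinors 𝒜 d x B (r + 1) (Module.finrank k (𝒜 (r + 1))) *
                ∏ i : Fin r, coeffMinors 𝒜 d x B (i + 1) (a i)).map
                  (coeffHom k A (Fin d × Fin m)) : Set (MvPolynomial (Fin d × Fin m) A))) := by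
  have : Infinite k := IsAlgClosed.instInfinite
  obtain ⟨r, hr⟩ := hA.exists_isGreatest B hd hd_pos hx
  exact ⟨r, hr, hA.bigReductionNumber_eq hd hd_pos hx hr,
    le_antisymm (le_iInf₂ fun a _ => hA.gradedCore_le_comap_colon hd hx a)
      (hA.iInf_comap_colon_le_gradedCore hd hd_pos hx hr)⟩
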